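/- Let $\Sigma$ be a finite alphabet and let $\vdash,\dashv\notin\Sigma$ be two end markers. A two-way two-tape automaton over $\Sigma$ has a finite set $Q$ of states, sets $I,F\subseteq Q$ of initial and final states, and a transition relation $\Delta\subseteq (Q\times(\Sigma\cup\{\vdash,\dashv\})^2)\times(Q\times\{-1,0,1\}^2)$. On input $(u,v)\in\Sigma^*\times\Sigma^*$ it reads the words $\vdash u\dashv$ and $\vdash v\dashv$ with one head each; a transition depends on the state and the two scanned symbols, and it gives the new state and the displacements of the two heads, which never cross the end markers. A configuration $(q,i,j)$ consists of the state and the two head positions; it is initial if $q\in I$ and both heads are on $\vdash$, and final if $q\in F$. The automaton is alternating if its states are partitioned into existential and universal ones. A run is then a tree labelled by configurations in which an inner node with existential label has a single child, labelled by a successor configuration, and an inner node with universal label has exactly one child for each successor configuration. A run is accepting if it is finite, its root is labelled by an initial configuration, and each leaf is labelled by a final configuration or by a universal configuration without successor. The automaton recognizes the relation of all pairs $(u,v)$ that have an accepting run. Theorem. For every finite alphabet $\Sigma$ with at least two letters, the class of relations $R\subseteq\Sigma^*\times\Sigma^*$ recognized by alternating two-way two-tape automata over $\Sigma$ is not closed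 under complementation: there is a recognized relation $R$ whose complement $(\Sigma^*\times\Sigma^*)\setminus R$ is not recognized. Moreover, over the five-letter alphabet $\{a,0,1,\#,\$\}$ the relation $$\mathcal P=\{(a^n,\ c_1\#\cdots\#c_n\,\$\,c_1\#\cdots\#c_n)\ :\ n\in\mathbb N,\ c_1,\dots,c_n\in\{0,1\}^n \text{ are the columns of an } n\times n \text{ permutation matrix}\}$$ is recognized by an alternating two-way two-tape automaton, and its complement is not. -/

import Mathlib

namespace TwoTape

/-- The symbols that can be scanned on a tape: the letters of the alphabet together with the
begin marker and the end marker. -/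
inductive TapeSymbol (α : Type*) where
  | beginMark : TapeSymbol α
  | letter : α → TapeSymbol α
  | endMark : TapeSymbol α

/-- The moves of a reading head. -/
inductive Move where
  | left
  | stay
  | right

/-- The displacement of the head caused by a move. -/
def Move.shift : Move → ℤ
  | .left => -1
  | .stay => 0
  | .right => 1

/-- The tape carrying the word `u`: the begin marker is at position `0`, the letters of `u` are
at positions `1, …, |u|`, and the end marker is at position `|u| + 1`. -/
def tape {α : Type*} (u : List α) : List (TapeSymbol α) :=
  TapeSymbol.beginMark :: (u.map TapeSymbol.letter ++ [TapeSymbol.endMark])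

/-- An alternating two-way two-tape automaton with alphabet `α` and state set `Q`. The states are
partitioned into the universal ones and the existential ones (those that are not universal).
`trans p x y q d e` says that from state `p`, scanning `x` on the first tape and `y` on the
second tape, the automaton may go to state `q`, moving the first head by `d` and the second
head by `e`. -/
structure AltAutomaton (α : Type*) (Q : Type*) where
  trans : Q → TapeSymbol α → TapeSymbol α → Q → Move → Move → Prop
  initial : Set Q
  final : Set Q
  universal : Set Q
  /-- the first head does not cross the word boundaries -/
  bound_fst : ∀ p x y q d e, trans p x y q d e →
    (x = TapeSymbol.beginMark → d ≠ Move.left) ∧ (x = TapeSymbol.endMark → d ≠ Move.right)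
  /-- the second head does not cross the word boundaries -/
  bound_snd : ∀ p x y q d e, trans p x y q d e →
    (y = TapeSymbol.beginMark → e ≠ Move.left) ∧ (y = TapeSymbol.endMark → e ≠ Move.right)

/-- A configuration: a control state and the positions of the two reading heads. -/
structure Config (Q : Type*) where
  state : Q
  pos₁ : ℕ
  pos₂ : ℕ

/-- Finite trees whose nodes are labelled by elements of `C`. -/
inductive FinTree (C : Type*) where
  | node : C → List (FinTree C) → FinTree C

namespace FinTree

/-- The label of the root. -/
def root {C : Type*} : FinTree C → C
  | node c _ => c

/-- `HasLeaf c t`: some leaf of the tree `t` is labelled by `c`. -/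
inductive HasLeaf {C : Type*} (c : C) : FinTree C → Prop where
  | here : HasLeaf c (node c [])
  | there (d : C) (ts : List (FinTree C)) (t : FinTree C) :
      t ∈ ts → HasLeaf c t → HasLeaf c (node d ts)

end FinTree

namespace AltAutomaton

variable {α Q : Type*}

/-- `A.Succ u v c c'`: on input `(u, v)`, the configuration `c'` is a successor of `c`. -/
def Succ (A : AltAutomaton α Q) (u v : List α) (c c' : Config Q) : Prop :=
  ∃ (x y : TapeSymbol α) (d e : Move),
    (tape u)[c.pos₁]? = some x ∧ (tape v)[c.pos₂]? = some y ∧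
    A.trans c.state x y c'.state d e ∧
    (c'.pos₁ : ℤ) = (c.pos₁ : ℤ) + d.shift ∧ (c'.pos₂ : ℤ) = (c.pos₂ : ℤ) + e.shift

/-- The finite runs of `A` on input `(u, v)`: finite trees labelled by configurations such that
an inner node with an existential label has a single child, labelled by a successor, and an
inner node with a universal label has exactly one child for each successor. -/
inductive IsRun (A : AltAutomaton α Q) (u v : List α) : FinTree (Config Q) → Prop where
  | leaf (c : Config Q) : IsRun A u v (FinTree.node c [])
  | existential (c : Config Q) (t : FinTree (Config Q)) :
      c.state ∉ A.universal → A.Succ u v c t.root → IsRun A u v t →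
      IsRun A u v (FinTree.node c [t])
  | universal (c : Config Q) (ts : List (FinTree (Config Q))) :
      c.state ∈ A.universal → (ts.map FinTree.root).Nodup →
      (∀ c', c' ∈ ts.map FinTree.root ↔ A.Succ u v c c') →
      (∀ t ∈ ts, IsRun A u v t) →
      IsRun A u v (FinTree.node c ts)

/-- A run is accepting if it is finite, its root is labelled by an initial configuration, and
each of its leaves is labelled by a final configuration or by a universal configuration without
successor. -/
def IsAcceptingRun (A : AltAutomaton α Q) (u v : List α) (t : FinTree (Config Q)) : Prop :=
  A.IsRun u v t ∧
  (t.root.state ∈ A.initial ∧ t.root.pos₁ = 0 ∧ t.root.pos₂ = 0) ∧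
  ∀ c, t.HasLeaf c →
    c.state ∈ A.final ∨ (c.state ∈ A.universal ∧ ∀ c', ¬ A.Succ u v c c')

/-- The relation accepted by `A`. -/
def relation (A : AltAutomaton α Q) : Set (List α × List α) :=
  {w | ∃ t, A.IsAcceptingRun w.1 w.2 t}

end AltAutomaton

/-- A relation between words over `α` is recognizable if it is accepted by some alternating
two-way two-tape automaton with finitely many states. -/
def Recognizable {α : Type*} (R : Set (List α × List α)) : Prop :=
  ∃ (Q : Type) (_ : Finite Q) (A : AltAutomaton α Q), A.relation = R

/-- The five-letter alphabet `{a, 0, 1, #, $}`. -/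
inductive Letter where
  | a
  | zero
  | one
  | hash
  | dollar
  deriving DecidableEq

/-- The `i`-th column of the 0/1 matrix of the permutation `σ`, as a word of length `n`. -/
def permColumn {n : ℕ} (σ : Equiv.Perm (Fin n)) (i : Fin n) : List Letter :=
  List.ofFn fun k : Fin n => if k = σ i then Letter.one else Letter.zero

/-- The word `c₁#c₂#⋯#cₙ`, where `c₁, …, cₙ` are the columns of the matrix of `σ`. -/
def permWord {n : ℕ} (σ : Equiv.Perm (Fin n)) : List Letter :=
  List.intercalate [Letter.hash] (List.ofFn (permColumn σ))

/-- The relation of all pairs `(aⁿ, c₁#⋯#cₙ$c₁#⋯#cₙ)` where `(c₁, …, cₙ)` are the columns of an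
`n × n` permutation matrix. -/
def permRelation : Set (List Letter × List Letter) :=
  {w | ∃ (n : ℕ) (σ : Equiv.Perm (Fin n)),
    w.1 = List.replicate n Letter.a ∧ w.2 = permWord σ ++ Letter.dollar :: permWord σ}

end TwoTape

/-! Exchanging existential and universal states does not complement an alternating automaton,
because accepting runs must be finite: an infinite play counts as rejecting before and after the
exchange. The separating relation compares two enumerations of the same `n` rows by asking whether a
certain game always terminates.

Recognition. Two enumerations `σ`, `τ` of `Fin n` are written one after the other on the second
tape, with a marker between the parts, and the first head stores a row as a position on `a^n`. In
the order game a universal player looks up the stored row in one of the two parts, walks left inside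
that part to another entry, and stores the row of that entry. If `σ = τ`, the place of the row in
the enumeration decreases at each step, so every play ends. If `σ ≠ τ`, some two rows occur in
opposite orders, and the play can alternate between them forever. Acceptance is a least fixed point,
so termination is what the automaton expresses (`terminates_iff_perm_eq`, `Definable.terminates`).
The automata are not written out: `Definable` is a small fixed-point calculus, closed under tests,
Boolean connectives, moves, one-directional searches and least fixed points.

Non-recognition. Suppose an automaton accepts the complement. To each `σ` belongs the set of
configurations with the second head next to the cut between the parts from which the code of `(σ,
σ)` is accepted. There are at most `2 ^ (2 * |Q| * (n + 2))` such sets but `n!` permutations, so two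
permutations `σ ≠ τ` share one. Then acceptance of the glued code of `(σ, τ)` carries over to that
of `(σ, σ)`, which must be rejected (`card_le_of_fooling`).

Over two letters the relation is simply termination of the game, evaluated on a binary code. For
`permRelation` the shape of the input is verified too: `WellFormed` lists conditions that the
calculus can express, and `WellFormed.exists_isGrid` recovers the permutation from them. -/

namespace TwoTape

/-! ### Acceptance as a least fixed point -/

namespace AltAutomaton

variable {α Q : Type*}

/-- Some finite run starting in `c` has only accepting leaves. -/
def Accepts (A : AltAutomaton α Q) (u v : List α) (c : Config Q) : Prop :=
  ∃ t, A.IsRun u v t ∧ t.root = c ∧ ∀ c', t.HasLeaf c' →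
    c'.state ∈ A.final ∨ (c'.state ∈ A.universal ∧ ∀ c'', ¬ A.Succ u v c' c'')

theorem mem_relation_iff (A : AltAutomaton α Q) (w : List α × List α) :
    w ∈ A.relation ↔ ∃ q ∈ A.initial, A.Accepts w.1 w.2 ⟨q, 0, 0⟩ := by
  constructor
  · rintro ⟨t, hr, ⟨hq, h1, h2⟩, hl⟩
    refine ⟨t.root.state, hq, t, hr, ?_, hl⟩
    cases h : t.root
    simp_all
  · rintro ⟨q, hq, t, hr, ht, hl⟩
    exact ⟨t, hr, by simp [ht, hq], hl⟩

/-- A set of configurations that is closed under the acceptance rules contains all accepted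
configurations. -/
theorem Accepts.of_closed {A : AltAutomaton α Q} {u v : List α} {X : Config Q → Prop}
    (hf : ∀ c, c.state ∈ A.final → X c)
    (he : ∀ c c', c.state ∉ A.universal → A.Succ u v c c' → X c' → X c)
    (hu : ∀ c, c.state ∈ A.universal → (∀ c', A.Succ u v c c' → X c') → X c)
    {c : Config Q} (h : A.Accepts u v c) : X c := by
  obtain ⟨t, hr, rfl, hl⟩ := h
  induction hr with
  | leaf c =>
    rcases hl c .here with h | ⟨h, h'⟩
    · exact hf _ h
    · exact hu _ h fun c' hc' => absurd hc' (h' c')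
  | existential c t hc hs hr ih =>
    exact he _ _ hc hs (ih fun c' hc' => hl c' (.there _ _ _ (by simp) hc'))
  | universal c ts hc hn hs hr ih =>
    refine hu _ hc fun c' hc' => ?_
    obtain ⟨t, ht, rfl⟩ := List.mem_map.1 ((hs c').2 hc')
    exact ih t ht fun c' hc' => hl c' (.there _ _ _ ht hc')

theorem accepts_of_final {A : AltAutomaton α Q} {u v : List α} {c : Config Q}
    (h : c.state ∈ A.final) : A.Accepts u v c := by
  refine ⟨.node c [], .leaf c, rfl, fun c' hc' => ?_⟩
  cases hc' with
  | here => exact Or.inl h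
  | there _ _ t ht => simp at ht

theorem accepts_of_existential {A : AltAutomaton α Q} {u v : List α} {c c' : Config Q}
    (h : c.state ∉ A.universal) (hs : A.Succ u v c c') (hc : A.Accepts u v c') :
    A.Accepts u v c := by
  obtain ⟨t, hr, rfl, hl⟩ := hc
  refine ⟨.node c [t], .existential c t h hs hr, rfl, fun d hd => ?_⟩
  cases hd with
  | there _ _ t' ht' hd => simp at ht'; subst ht'; exact hl d hd

/-- A universal node lists a child for each successor, so a run through it exists only because the
successors are finite in number. -/
theorem finite_succ [Finite Q] (A : AltAutomaton α Q) (u v : List α) (c : Config Q) :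
    {c' | A.Succ u v c c'}.Finite := by
  have hfin : (Set.univ ×ˢ (Set.Iic (c.pos₁ + 1) ×ˢ Set.Iic (c.pos₂ + 1)) :
      Set (Q × ℕ × ℕ)).Finite :=
    Set.finite_univ.prod ((Set.finite_Iic _).prod (Set.finite_Iic _))
  refine (hfin.image fun x => (⟨x.1, x.2.1, x.2.2⟩ : Config Q)).subset ?_
  rintro ⟨q, i, j⟩ ⟨x, y, d, e, -, -, -, h1, h2⟩
  refine ⟨(q, i, j), ?_, rfl⟩
  simp only [Set.mem_prod, Set.mem_univ, Set.mem_Iic, true_and]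
  cases d <;> cases e <;> simp [Move.shift] at h1 h2 <;> omega

theorem accepts_of_universal [Finite Q] {A : AltAutomaton α Q} {u v : List α} {c : Config Q}
    (h : c.state ∈ A.universal) (hs : ∀ c', A.Succ u v c c' → A.Accepts u v c') :
    A.Accepts u v c := by
  classical
  have hs' : ∀ c', ∃ t, A.Succ u v c c' → (A.IsRun u v t ∧ t.root = c' ∧ ∀ d, t.HasLeaf d →
      d.state ∈ A.final ∨ (d.state ∈ A.universal ∧ ∀ c'', ¬ A.Succ u v d c'')) := fun c' => by
    by_cases hc : A.Succ u v c c'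
    · obtain ⟨t, ht⟩ := hs c' hc
      exact ⟨t, fun _ => ht⟩
    · exact ⟨.node c [], fun h => absurd h hc⟩
  choose t ht using hs'
  set l := (A.finite_succ u v c).toFinset.toList with hl
  have hmem : ∀ c', c' ∈ l ↔ A.Succ u v c c' := by simp [hl]
  have hmap : (l.map t).map FinTree.root = l := by
    rw [List.map_map]
    conv_rhs => rw [← List.map_id l]
    exact List.map_congr_left fun c' hc' => (ht c' ((hmem c').1 hc')).2.1
  refine ⟨.node c (l.map t), .universal c _ h ?_ ?_ ?_, rfl, ?_⟩
  · rw [hmap]; exact Finset.nodup_toList _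
  · rw [hmap]; exact hmem
  · intro s hs
    obtain ⟨c', hc', rfl⟩ := List.mem_map.1 hs
    exact (ht c' ((hmem c').1 hc')).1
  · intro d hd
    generalize hts : l.map t = ts at hd
    cases hd with
    -- The root is a leaf only if the list of successors is empty.
    | here =>
      refine Or.inr ⟨h, fun c' hc' => ?_⟩
      have := (hmem c').2 hc'
      simp at hts
      simp [hts] at this
    | there _ _ s hs hd =>
      subst hts
      obtain ⟨c', hc', rfl⟩ := List.mem_map.1 hs
      exact (ht c' ((hmem c').1 hc')).2.2 d hd

end AltAutomaton

/-! ### Symbols on the tape -/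

theorem tape_getElem?_succ {α : Type*} (u : List α) {i : ℕ} (h : i < u.length) :
    (tape u)[i + 1]? = some (TapeSymbol.letter u[i]) := by
  simp [tape, List.getElem?_append, h]

theorem tape_getElem?_length {α : Type*} (u : List α) :
    (tape u)[u.length + 1]? = some TapeSymbol.endMark := by
  simp [tape]

theorem length_tape {α : Type*} (u : List α) : (tape u).length = u.length + 2 := by
  simp [tape]

theorem tape_getElem?_eq_beginMark {α : Type*} (u : List α) {i : ℕ} :
    (tape u)[i]? = some TapeSymbol.beginMark ↔ i = 0 := by
  rcases i with _ | i
  · simp [tape]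
  · rcases lt_trichotomy i u.length with h | rfl | h
    · simp [tape_getElem?_succ u h]
    · simp [tape_getElem?_length]
    · have : (tape u)[i + 1]? = none := by simp [length_tape]; omega
      simp [this]

theorem tape_getElem?_eq_endMark {α : Type*} (u : List α) {i : ℕ} :
    (tape u)[i]? = some TapeSymbol.endMark ↔ i = u.length + 1 := by
  rcases i with _ | i
  · simp [tape]
  · rcases lt_trichotomy i u.length with h | rfl | h
    · simp [tape_getElem?_succ u h]; omega
    · simp [tape_getElem?_length]
    · have : (tape u)[i + 1]? = none := by simp [length_tape]; omega
      simp [this]; omega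

theorem tape_getElem?_congr {α : Type*} {u u' : List α} (hl : u.length = u'.length) {i : ℕ}
    (h : u[i - 1]? = u'[i - 1]?) : (tape u)[i]? = (tape u')[i]? := by
  rcases i with _ | i
  · rfl
  · simp only [Nat.add_sub_cancel] at h
    simp [tape, List.getElem?_append, hl, h]

theorem tape_injective {α : Type*} {u u' : List α} (h : tape u = tape u') : u = u' := by
  simp only [tape, List.cons.injEq, true_and] at h
  have h' := List.append_cancel_right h
  exact List.map_injective_iff.2 (fun a b hab => by simpa using hab) h'

/-- The second head moves by at most one cell, so it passes a cut between `l` and `l + 1` only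
through these two positions; the first head has only `u.length + 2` positions. -/
theorem AltAutomaton.Succ.bounds {α Q : Type*} {A : AltAutomaton α Q} {u v : List α}
    {c c' : Config Q} (h : A.Succ u v c c') :
    c'.pos₁ ≤ u.length + 1 ∧ c'.pos₂ ≤ c.pos₂ + 1 ∧ c.pos₂ ≤ c'.pos₂ + 1 := by
  obtain ⟨x, y, d, e, hx, hy, ht, h1, h2⟩ := h
  have hb := A.bound_fst _ _ _ _ _ _ ht
  have hlt : c.pos₁ < (tape u).length := by
    by_contra hc
    simp [List.getElem?_eq_none (not_lt.1 hc)] at hx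
  rw [length_tape] at hlt
  have hend : c.pos₁ = u.length + 1 → d ≠ Move.right := fun hc => by
    rw [hc, tape_getElem?_length] at hx
    exact hb.2 (Option.some.inj hx).symm
  refine ⟨?_, ?_, ?_⟩
  · cases d <;> simp [Move.shift] at h1 hend <;> omega
  · cases e <;> simp [Move.shift] at h2 <;> omega
  · cases e <;> simp [Move.shift] at h2 <;> omega

/-! ### Fooling and counting -/

/-- A cut-and-paste bound: if the words `w i j` are glued from a part depending on `i` and a part
depending on `j`, and an alternating automaton tells the words `w i i` from the words `w i j` with
`i ≠ j` by rejecting the former and accepting the latter, then the number of indices is at most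
exponential in the length of the first input word. -/
theorem card_le_of_fooling {α Q ι : Type*} [Finite Q] [Finite ι] (A : AltAutomaton α Q)
    (u : List α) (w : ι → ι → List α) (l : ℕ) (hlen : ∀ i j i' j', (w i j).length = (w i' j').length)
    (hleft : ∀ i j p, p < l → (w i j)[p]? = (w i i)[p]?)
    (hright : ∀ i j p, l ≤ p → (w i j)[p]? = (w j j)[p]?)
    (hrej : ∀ i, (u, w i i) ∉ A.relation) (hacc : ∀ i j, i ≠ j → (u, w i j) ∈ A.relation) :
    Nat.card ι ≤ 2 ^ (Nat.card Q * ((u.length + 2) * 2)) := by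
  classical
  -- The crossing set of `i`: the accepted configurations with the second head at `l` or `l + 1`,
  -- the two sides of the cut.
  let S : ι → Set (Q × Fin (u.length + 2) × Fin 2) := fun i =>
    {x | A.Accepts u (w i i) ⟨x.1, x.2.1, l + x.2.2⟩}
  have hS : Function.Injective S := by
    intro i j hij
    by_contra hne
    have htl : ∀ p, p ≤ l → (tape (w i j))[p]? = (tape (w i i))[p]? := fun p hp => by
      rcases p with _ | p
      · rfl
      · exact tape_getElem?_congr (hlen _ _ _ _) (hleft i j _ (by omega))
    have htr : ∀ p, l < p → (tape (w i j))[p]? = (tape (w j j))[p]? := fun p hp =>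
      tape_getElem?_congr (hlen _ _ _ _) (hright i j _ (by omega))
    have hagree : ∀ c : Config Q, c.pos₁ ≤ u.length + 1 → l ≤ c.pos₂ → c.pos₂ ≤ l + 1 →
        (A.Accepts u (w i i) c ↔ A.Accepts u (w j j) c) := by
      rintro ⟨q, a, b⟩ ha hb hb'
      simp only at ha hb hb'
      have := Set.ext_iff.1 hij (q, ⟨a, by omega⟩, ⟨b - l, by omega⟩)
      simpa [S, Nat.add_sub_cancel' hb] using this
    -- On `w i j`, the configurations left of the cut are judged by `w i i` and those right of it by
    -- `w j j`. Equality of the crossing sets makes this closed under the acceptance rules, so it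
    -- contains the initial configuration, which lies on the left.
    let X : Config Q → Prop := fun c => c.pos₁ ≤ u.length + 1 →
      if c.pos₂ ≤ l then A.Accepts u (w i i) c else A.Accepts u (w j j) c
    have hsl : ∀ c c' : Config Q, c.pos₂ ≤ l →
        (A.Succ u (w i j) c c' ↔ A.Succ u (w i i) c c') := fun c c' hc => by
      simp only [AltAutomaton.Succ, htl _ hc]
    have hsr : ∀ c c' : Config Q, l < c.pos₂ →
        (A.Succ u (w i j) c c' ↔ A.Succ u (w j j) c c') := fun c c' hc => by
      simp only [AltAutomaton.Succ, htr _ hc]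
    have hXl : ∀ c c' : Config Q, c.pos₂ ≤ l → A.Succ u (w i j) c c' →
        X c' → A.Accepts u (w i i) c' := fun c c' hc hs hX => by
      have hb := hs.bounds
      have hX := hX hb.1
      split_ifs at hX with h
      · exact hX
      · exact (hagree c' hb.1 (by omega) (by omega)).2 hX
    have hXr : ∀ c c' : Config Q, l < c.pos₂ → A.Succ u (w i j) c c' →
        X c' → A.Accepts u (w j j) c' := fun c c' hc hs hX => by
      have hb := hs.bounds
      have hX := hX hb.1
      split_ifs at hX with h
      · exact (hagree c' hb.1 (by omega) (by omega)).1 hX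
      · exact hX
    obtain ⟨q, hq, hw⟩ := (A.mem_relation_iff _).1 (hacc i j hne)
    have hX : X ⟨q, 0, 0⟩ := by
      refine hw.of_closed (X := X) ?_ ?_ ?_
      · intro c hc _
        split_ifs <;> exact AltAutomaton.accepts_of_final hc
      · intro c c' hc hs hX _
        split_ifs with h
        · exact AltAutomaton.accepts_of_existential hc ((hsl c c' h).1 hs) (hXl c c' h hs hX)
        · have h := not_le.1 h
          exact AltAutomaton.accepts_of_existential hc ((hsr c c' h).1 hs) (hXr c c' h hs hX)
      · intro c hc hX _
        split_ifs with h
        · refine AltAutomaton.accepts_of_universal hc fun c' hs => ?_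
          have hs := (hsl c c' h).2 hs
          exact hXl c c' h hs (hX c' hs)
        · have h := not_le.1 h
          refine AltAutomaton.accepts_of_universal hc fun c' hs => ?_
          have hs := (hsr c c' h).2 hs
          exact hXr c c' h hs (hX c' hs)
    have := hX (Nat.zero_le _)
    simp only [Nat.zero_le, if_true] at this
    exact hrej i ((A.mem_relation_iff _).2 ⟨q, hq, this⟩)
  have := Nat.card_le_card_of_injective S hS
  have hc : Nat.card (Set (Q × Fin (u.length + 2) × Fin 2)) =
      2 ^ (Nat.card Q * ((u.length + 2) * 2)) := by
    have : Fintype Q := Fintype.ofFinite Q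
    simp
  rwa [hc] at this

/-- Factorials outgrow exponentials. -/
theorem exists_two_pow_lt_factorial (c : ℕ) :
    ∃ n, 0 < n ∧ 2 ^ (c * ((n + 2) * 2)) < n.factorial := by
  -- The bound equals `2 ^ (4c) * (2 ^ (2c)) ^ n`, a constant times an exponential in `n`.
  have h := FloorSemiring.eventually_mul_pow_lt_factorial_sub ((2 : ℝ) ^ (c * 4)) (2 ^ (c * 2)) 0
  obtain ⟨n, hn, h0⟩ := (h.and (Filter.eventually_gt_atTop 0)).exists
  refine ⟨n, h0, ?_⟩
  rw [← pow_mul, ← pow_add, Nat.sub_zero,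
    show c * 4 + c * 2 * n = c * ((n + 2) * 2) by ring] at hn
  exact_mod_cast hn

/-- A relation is not recognizable if, for all large `n`, it tells apart permutations of
`{0, …, n - 1}` coded by words which are glued from two independent parts. -/
theorem not_recognizable_compl {α : Type*} (R : Set (List α × List α)) (u : ℕ → List α)
    (hu : ∀ n, (u n).length = n)
    (w : ∀ n, Equiv.Perm (Fin n) → Equiv.Perm (Fin n) → List α) (l : ℕ → ℕ)
    (hlen : ∀ n σ τ σ' τ', (w n σ τ).length = (w n σ' τ').length)
    (hleft : ∀ n σ τ p, p < l n → (w n σ τ)[p]? = (w n σ σ)[p]?)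
    (hright : ∀ n σ τ p, l n ≤ p → (w n σ τ)[p]? = (w n τ τ)[p]?)
    (hR : ∀ n, 0 < n → ∀ σ τ, (u n, w n σ τ) ∈ R ↔ σ = τ) : ¬ Recognizable Rᶜ := by
  rintro ⟨Q, _, A, hA⟩
  obtain ⟨n, h0, hn⟩ := exists_two_pow_lt_factorial (Nat.card Q)
  have := card_le_of_fooling A (u n) (w n) (l n) (hlen n) (hleft n) (hright n)
    (fun σ => by rw [hA]; simp [hR n h0]) (fun σ τ h => by rw [hA]; simp [hR n h0, h])
  rw [hu, Nat.card_eq_fintype_card, Fintype.card_perm, Fintype.card_fin] at this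
  omega

/-! ### Automata with exits and definable predicates -/

/-- A pair of head positions on the tapes carrying `u` and `v`. -/
def Valid {α : Type*} (u v : List α) (i j : ℕ) : Prop := i ≤ u.length + 1 ∧ j ≤ v.length + 1

/-- The heads move from `(i, j)` to `(i', j')` by the displacements `d` and `e`. -/
def Moves (d e : Move) (i j i' j' : ℕ) : Prop :=
  (i' : ℤ) = i + d.shift ∧ (j' : ℤ) = j + e.shift

/-- Alternating automata with exits `O`, whose moves are restricted to the tapes. -/
structure ExitAutomaton (α : Type*) (O Q : Type) where
  step : Q → TapeSymbol α → TapeSymbol α → Q ⊕ O → Move → Move → Prop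
  universal : Q → Prop

namespace ExitAutomaton

variable {α : Type*} {O Q : Type}

/-- The successors of a configuration. -/
def Next (M : ExitAutomaton α O Q) (u v : List α) (q : Q) (i j : ℕ) (s : Q ⊕ O) (i' j' : ℕ) :
    Prop :=
  Valid u v i' j' ∧ ∃ x y d e, (tape u)[i]? = some x ∧ (tape v)[j]? = some y ∧
    M.step q x y s d e ∧ Moves d e i j i' j'

/-- The acceptance condition of a configuration in terms of its successors. -/
def Cond (M : ExitAutomaton α O Q) (u v : List α) (Z : Q ⊕ O → ℕ → ℕ → Prop) (q : Q) (i j : ℕ) :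
    Prop :=
  (M.universal q ∧ ∀ s i' j', M.Next u v q i j s i' j' → Z s i' j') ∨
  (¬ M.universal q ∧ ∃ s i' j', M.Next u v q i j s i' j' ∧ Z s i' j')

theorem Cond.mono {M : ExitAutomaton α O Q} {u v : List α} {Z Z' : Q ⊕ O → ℕ → ℕ → Prop}
    {q : Q} {i j : ℕ} (hZ : ∀ s i j, Valid u v i j → Z s i j → Z' s i j)
    (h : M.Cond u v Z q i j) : M.Cond u v Z' q i j := by
  rcases h with ⟨h, h'⟩ | ⟨h, s, i', j', hn, h'⟩
  · exact Or.inl ⟨h, fun s i' j' hn => hZ _ _ _ hn.1 (h' s i' j' hn)⟩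
  · exact Or.inr ⟨h, s, i', j', hn, hZ _ _ _ hn.1 h'⟩

/-- The set `Z` of configurations contains the exit configurations in `Y` and is closed under the
acceptance condition. -/
def Closed (M : ExitAutomaton α O Q) (u v : List α) (Y : O → ℕ → ℕ → Prop)
    (Z : Q ⊕ O → ℕ → ℕ → Prop) : Prop :=
  (∀ o i j, Valid u v i j → Y o i j → Z (.inr o) i j) ∧
  ∀ q i j, Valid u v i j → M.Cond u v Z q i j → Z (.inl q) i j

/-- The accepted configurations, given the set `Y` of accepted exit configurations. -/
def Acc (M : ExitAutomaton α O Q) (u v : List α) (Y : O → ℕ → ℕ → Prop) (s : Q ⊕ O) (i j : ℕ) :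
    Prop :=
  ∀ Z, M.Closed u v Y Z → Z s i j

theorem closed_acc (M : ExitAutomaton α O Q) (u v : List α) (Y : O → ℕ → ℕ → Prop) :
    M.Closed u v Y (M.Acc u v Y) :=
  ⟨fun o i j hv h _ hZ => hZ.1 o i j hv h, fun q i j hv h Z hZ =>
    hZ.2 q i j hv (h.mono fun _ _ _ _ h => h Z hZ)⟩

theorem acc_inr {M : ExitAutomaton α O Q} {u v : List α} {Y : O → ℕ → ℕ → Prop} {o : O} {i j : ℕ}
    (hv : Valid u v i j) : M.Acc u v Y (.inr o) i j ↔ Y o i j := by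
  refine ⟨fun h => h (fun s => match s with | .inl _ => fun _ _ => True | .inr o => Y o)
    ⟨fun o i j _ h => h, fun _ _ _ _ _ => trivial⟩, fun h => (M.closed_acc u v Y).1 o i j hv h⟩

/-- Knaster–Tarski: the least closed set is a fixed point, because its own one-step unfolding is
closed. -/
theorem acc_inl {M : ExitAutomaton α O Q} {u v : List α} {Y : O → ℕ → ℕ → Prop} {q : Q} {i j : ℕ}
    (hv : Valid u v i j) :
    M.Acc u v Y (.inl q) i j ↔ M.Cond u v (M.Acc u v Y) q i j := by
  refine ⟨fun h => ?_, (M.closed_acc u v Y).2 q i j hv⟩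
  have := h (fun s i j => match s with
    | .inl q => M.Cond u v (M.Acc u v Y) q i j
    | .inr o => M.Acc u v Y (.inr o) i j) ⟨(M.closed_acc u v Y).1, fun q i j _ h =>
      h.mono fun s i j hv h => ?_⟩
  · exact this
  · rcases s with q | o
    · exact (M.closed_acc u v Y).2 q i j hv h
    · exact h

/-- When one automaton is embedded into another by renaming the targets of its transitions,
acceptance is pulled back along the renaming. -/
theorem cond_map {O' Q' : Type} {M : ExitAutomaton α O Q} {K : ExitAutomaton α O' Q'} {q : Q}
    {q' : Q'} (f : Q ⊕ O → Q' ⊕ O')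
    (hs : ∀ x y s d e, K.step q' x y s d e ↔ ∃ t, M.step q x y t d e ∧ s = f t)
    (hu : K.universal q' ↔ M.universal q) (u v : List α) (Z : Q' ⊕ O' → ℕ → ℕ → Prop) (i j : ℕ) :
    K.Cond u v Z q' i j ↔ M.Cond u v (fun s => Z (f s)) q i j := by
  have hnext : ∀ s i' j', K.Next u v q' i j s i' j' ↔ ∃ t, M.Next u v q i j t i' j' ∧ s = f t := by
    intro s i' j'
    constructor
    · rintro ⟨hv, x, y, d, e, hx, hy, ht, hm⟩
      obtain ⟨t, ht, hst⟩ := (hs ..).1 ht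
      exact ⟨t, ⟨hv, x, y, d, e, hx, hy, ht, hm⟩, hst⟩
    · rintro ⟨t, ⟨hv, x, y, d, e, hx, hy, ht, hm⟩, hst⟩
      exact ⟨hv, x, y, d, e, hx, hy, (hs ..).2 ⟨t, ht, hst⟩, hm⟩
  simp only [Cond, hnext, hu]
  refine or_congr (and_congr Iff.rfl ⟨fun h s i' j' hn => h _ i' j' ⟨s, hn, rfl⟩, ?_⟩)
    (and_congr Iff.rfl ⟨?_, ?_⟩)
  · rintro h s i' j' ⟨t, hn, rfl⟩
    exact h _ _ _ hn
  · rintro ⟨s, i', j', ⟨t, hn, rfl⟩, hZ⟩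
    exact ⟨t, i', j', hn, hZ⟩
  · rintro ⟨t, i', j', hn, hZ⟩
    exact ⟨_, i', j', ⟨t, hn, rfl⟩, hZ⟩

end ExitAutomaton

/-- A predicate of two words, a set `X` of pairs of head positions and a pair of head positions is
definable if it is computed by an automaton which accepts on exit if and only if the head
positions are in `X`. -/
def Definable {α : Type*} (Φ : List α → List α → (ℕ → ℕ → Prop) → ℕ → ℕ → Prop) : Prop :=
  ∃ (Q : Type) (_ : Finite Q) (M : ExitAutomaton α Unit Q) (q : Q), ∀ u v X i j, Valid u v i j →
    (Φ u v X i j ↔ M.Acc u v (fun _ => X) (.inl q) i j)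

namespace Definable

variable {α : Type*}

theorem congr {Φ Ψ : List α → List α → (ℕ → ℕ → Prop) → ℕ → ℕ → Prop} (h : Definable Φ)
    (hΨ : ∀ u v X i j, Valid u v i j → (Ψ u v X i j ↔ Φ u v X i j)) : Definable Ψ := by
  obtain ⟨Q, hQ, M, q, hM⟩ := h
  exact ⟨Q, hQ, M, q, fun u v X i j hv => (hΨ u v X i j hv).trans (hM u v X i j hv)⟩

/-- Calling automata for the definable predicates `Φ o` on exit. -/
theorem comp {O Q : Type} [Finite O] [Finite Q]
    {Φ : O → List α → List α → (ℕ → ℕ → Prop) → ℕ → ℕ → Prop} (hΦ : ∀ o, Definable (Φ o))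
    (M : ExitAutomaton α O Q) (q : Q) :
    Definable fun u v X => M.Acc u v (fun o => Φ o u v X) (.inl q) := by
  choose P hP N p hN using hΦ
  let inj : Q ⊕ O → (Q ⊕ Σ o, P o) ⊕ Unit := fun s => match s with
    | .inl q => .inl (.inl q)
    | .inr o => .inl (.inr ⟨o, p o⟩)
  let inj' : ∀ o, P o ⊕ Unit → (Q ⊕ Σ o, P o) ⊕ Unit := fun o s => match s with
    | .inl r => .inl (.inr ⟨o, r⟩)
    | .inr _ => .inr ()
  let K : ExitAutomaton α Unit (Q ⊕ Σ o, P o) :=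
    { step := fun q x y s d e => match q with
        | .inl q => ∃ t, M.step q x y t d e ∧ s = inj t
        | .inr ⟨o, r⟩ => ∃ t, (N o).step r x y t d e ∧ s = inj' o t
      universal := fun q => match q with
        | .inl q => M.universal q
        | .inr ⟨o, r⟩ => (N o).universal r }
  have hcond : ∀ u v Z q i j, K.Cond u v Z (.inl q) i j ↔
      M.Cond u v (fun s => Z (inj s)) q i j := fun u v Z q i j =>
    ExitAutomaton.cond_map inj (fun _ _ _ _ _ => Iff.rfl) Iff.rfl u v Z i j
  have hcond' : ∀ u v Z o r i j, K.Cond u v Z (.inr ⟨o, r⟩) i j ↔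
      (N o).Cond u v (fun s => Z (inj' o s)) r i j := fun u v Z o r i j =>
    ExitAutomaton.cond_map (inj' o) (fun _ _ _ _ _ => Iff.rfl) Iff.rfl u v Z i j
  refine ⟨Q ⊕ Σ o, P o, inferInstance, K, .inl q, fun u v X i j hv => ⟨fun h => ?_, fun h => ?_⟩⟩
  · have hcall : ∀ o r i j, Valid u v i j → (N o).Acc u v (fun _ => X) r i j →
        K.Acc u v (fun _ => X) (inj' o r) i j := by
      intro o r i j hv h
      refine h (fun s => K.Acc u v (fun _ => X) (inj' o s))
        ⟨fun _ i j hv h => ?_, fun r i j hv h => ?_⟩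
      · exact (K.closed_acc _ _ _).1 () i j hv h
      · exact (K.closed_acc _ _ _).2 _ i j hv ((hcond' ..).2 h)
    refine h (fun s => K.Acc u v (fun _ => X) (inj s)) ⟨fun o i j hv h => ?_, fun r i j hv h => ?_⟩
    · exact hcall o (.inl (p o)) i j hv ((hN o u v X i j hv).1 h)
    · exact (K.closed_acc _ _ _).2 _ i j hv ((hcond ..).2 h)
  -- Each state of `K` is read as acceptance in the component it comes from. This reading is closed
  -- under the rules of `K`, hence contains the least closed set.
  · refine h (fun s i j => match s with
      | .inl (.inl q) => M.Acc u v (fun o => Φ o u v X) (.inl q) i j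
      | .inl (.inr ⟨o, r⟩) => (N o).Acc u v (fun _ => X) (.inl r) i j
      | .inr _ => X i j) ⟨fun _ i j _ h => h, ?_⟩
    rintro (q | ⟨o, r⟩) i j hv h
    · refine (M.closed_acc _ _ _).2 _ i j hv (((hcond ..).1 h).mono fun s i j hv h => ?_)
      rcases s with q | o
      · exact h
      · exact (M.closed_acc _ _ _).1 o i j hv ((hN o u v X i j hv).2 h)
    · refine ((N o).closed_acc _ _ _).2 _ i j hv (((hcond' ..).1 h).mono fun s i j hv h => ?_)
      rcases s with q | _
      · exact h
      · exact ((N o).closed_acc _ _ _).1 () i j hv h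

/-- The least fixed point of a definable operator is definable. -/
theorem lfp {Φ : List α → List α → (ℕ → ℕ → Prop) → ℕ → ℕ → Prop} (h : Definable Φ) :
    Definable fun u v _ i j => ∀ X : ℕ → ℕ → Prop,
      (∀ i j, Valid u v i j → Φ u v X i j → X i j) → X i j := by
  obtain ⟨Q, hQ, M, q, hM⟩ := h
  -- Taking the exit restarts the automaton, so the variable comes to stand for the predicate being
  -- defined.
  let inj : Q ⊕ Unit → Q ⊕ Unit := fun s => match s with
    | .inl q => .inl q
    | .inr _ => .inl q
  let K : ExitAutomaton α Unit Q :=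
    { step := fun q x y s d e => ∃ t, M.step q x y t d e ∧ s = inj t
      universal := M.universal }
  have hcond : ∀ u v Z q i j, K.Cond u v Z q i j ↔
      M.Cond u v (fun s => Z (inj s)) q i j := fun u v Z q i j =>
    ExitAutomaton.cond_map (M := M) (K := K) inj (fun _ _ _ _ _ => Iff.rfl) Iff.rfl u v Z i j
  refine ⟨Q, hQ, K, q, fun u v Y i j hv => ⟨fun h => ?_, fun h X hX => ?_⟩⟩
  · refine h (fun i j => K.Acc u v (fun _ => Y) (.inl q) i j) fun i j hv h => ?_
    refine (hM _ _ _ _ _ hv).1 h (fun s => K.Acc u v (fun _ => Y) (inj s))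
      ⟨fun _ i j hv h => h, fun r i j hv h => ?_⟩
    exact (K.closed_acc _ _ _).2 _ i j hv ((hcond ..).2 h)
  · refine hX _ _ hv ((hM _ _ _ _ _ hv).2 ?_)
    refine h (fun s => match s with
      | .inl q => M.Acc u v (fun _ => X) (.inl q)
      | .inr _ => fun _ _ => True) ⟨fun _ _ _ _ _ => trivial, fun r i j hv h => ?_⟩
    refine (M.closed_acc _ _ _).2 _ i j hv (((hcond ..).1 h).mono fun s i j hv h => ?_)
    rcases s with q | _
    · exact h
    · exact (M.closed_acc _ _ _).1 () i j hv (hX _ _ hv ((hM _ _ _ _ _ hv).2 h))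

/-- Definable predicates yield recognizable relations. -/
theorem recognizable {Φ : List α → List α → (ℕ → ℕ → Prop) → ℕ → ℕ → Prop} (h : Definable Φ) :
    Recognizable {w | Φ w.1 w.2 (fun _ _ => False) 0 0} := by
  obtain ⟨Q, hQ, M, q, hM⟩ := h
  -- The exit becomes an existential state without transitions and no state is final, so acceptance
  -- comes only from universal configurations without successor.
  let A : AltAutomaton α (Q ⊕ Unit) :=
    { trans := fun p x y s d e =>
        ((x = TapeSymbol.beginMark → d ≠ Move.left) ∧ (x = TapeSymbol.endMark → d ≠ Move.right)) ∧
        ((y = TapeSymbol.beginMark → e ≠ Move.left) ∧ (y = TapeSymbol.endMark → e ≠ Move.right)) ∧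
        match p with
        | .inl q => M.step q x y s d e
        | .inr _ => False
      initial := {.inl q}
      final := ∅
      universal := {s | match s with
        | .inl q => M.universal q
        | .inr _ => False}
      bound_fst := fun _ _ _ _ _ _ h => h.1
      bound_snd := fun _ _ _ _ _ _ h => h.2.1 }
  have hsucc : ∀ u v q i j s i' j', Valid u v i j →
      (A.Succ u v ⟨.inl q, i, j⟩ ⟨s, i', j'⟩ ↔ M.Next u v q i j s i' j') := by
    intro u v q i j s i' j' hv
    -- Staying on the tape is the same as not moving outwards at a marker; this matches the validity
    -- requirement in `Next` with the boundary conditions of `AltAutomaton`.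
    have key : ∀ (u : List α) (i i' : ℕ) (x : TapeSymbol α) (d : Move), i ≤ u.length + 1 →
        (tape u)[i]? = some x → (i' : ℤ) = i + d.shift →
        (((x = TapeSymbol.beginMark → d ≠ Move.left) ∧
          (x = TapeSymbol.endMark → d ≠ Move.right)) ↔ i' ≤ u.length + 1) := by
      intro u i i' x d hi hx hm
      have h1 := tape_getElem?_eq_beginMark u (i := i)
      have h2 := tape_getElem?_eq_endMark u (i := i)
      rw [hx, Option.some.injEq] at h1 h2
      rw [h1, h2]
      cases d <;> simp [Move.shift] at hm ⊢ <;> omega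
    constructor
    · rintro ⟨x, y, d, e, hx, hy, ⟨h1, h2, h3⟩, hm⟩
      exact ⟨⟨(key u i i' x d hv.1 hx hm.1).1 h1, (key v j j' y e hv.2 hy hm.2).1 h2⟩,
        x, y, d, e, hx, hy, h3, hm⟩
    · rintro ⟨hv', x, y, d, e, hx, hy, h3, hm⟩
      exact ⟨x, y, d, e, hx, hy, ⟨(key u i i' x d hv.1 hx hm.1).2 hv'.1,
        (key v j j' y e hv.2 hy hm.2).2 hv'.2, h3⟩, hm⟩
  refine ⟨Q ⊕ Unit, inferInstance, A, ?_⟩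
  ext ⟨u, v⟩
  have hv0 : Valid u v 0 0 := ⟨Nat.zero_le _, Nat.zero_le _⟩
  rw [AltAutomaton.mem_relation_iff]
  simp only [A, Set.mem_singleton_iff, exists_eq_left, Set.mem_ofPred_eq]
  rw [hM _ _ _ _ _ hv0]
  constructor
  · intro h
    refine AltAutomaton.Accepts.of_closed (A := A) (X := fun c => Valid u v c.pos₁ c.pos₂ →
      M.Acc u v (fun _ _ _ => False) c.state c.pos₁ c.pos₂) ?_ ?_ ?_ h hv0
    · intro c hc; exact absurd hc (Set.notMem_empty _)
    · rintro ⟨q | _, i, j⟩ ⟨s, i', j'⟩ hu hs hX hv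
      · have hn := (hsucc _ _ _ _ _ _ _ _ hv).1 hs
        exact (M.closed_acc _ _ _).2 _ _ _ hv (Or.inr ⟨hu, s, i', j', hn, hX hn.1⟩)
      · obtain ⟨x, y, d, e, -, -, ht, -⟩ := hs
        exact ht.2.2.elim
    · rintro ⟨q | _, i, j⟩ hu hX hv
      · refine (M.closed_acc _ _ _).2 _ _ _ hv (Or.inl ⟨hu, fun s i' j' hn => ?_⟩)
        exact hX ⟨s, i', j'⟩ ((hsucc _ _ _ _ _ _ _ _ hv).2 hn) hn.1
      · exact hu.elim
  · intro h
    refine h (fun s i j => A.Accepts u v ⟨s, i, j⟩) ⟨fun _ _ _ _ h => h.elim, ?_⟩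
    rintro q i j hv (⟨hu, h⟩ | ⟨hu, s, i', j', hn, h⟩)
    · refine AltAutomaton.accepts_of_universal (A := A) hu ?_
      rintro ⟨s, i', j'⟩ hs
      exact h _ _ _ ((hsucc _ _ _ _ _ _ _ _ hv).1 hs)
    · exact AltAutomaton.accepts_of_existential (A := A) hu
        ((hsucc _ _ _ _ _ _ _ _ hv).2 hn) h

end Definable

/-! ### Closure under connectives, moves and searches -/

theorem Moves.exists_measure {d e : Move} (h : ¬ (d = Move.stay ∧ e = Move.stay)) (m n : ℕ) :
    ∃ μ : ℕ → ℕ → ℕ, ∀ i j i' j', i' ≤ m → j' ≤ n → Moves d e i j i' j' → μ i' j' < μ i j := by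
  cases d
  · exact ⟨fun i _ => i, fun i j i' j' _ _ hm => by simp [Moves, Move.shift] at hm ⊢; omega⟩
  · cases e
    · exact ⟨fun _ j => j, fun i j i' j' _ _ hm => by simp [Moves, Move.shift] at hm ⊢; omega⟩
    · simp at h
    · exact ⟨fun _ j => n + 1 - j, fun i j i' j' _ _ hm => by
        simp [Moves, Move.shift] at hm ⊢; omega⟩
  · exact ⟨fun i _ => m + 1 - i, fun i j i' j' _ _ hm => by
      simp [Moves, Move.shift] at hm ⊢; omega⟩

theorem Valid.exists_symbols {α : Type*} {u v : List α} {i j : ℕ} (h : Valid u v i j) :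
    ∃ x y, (tape u)[i]? = some x ∧ (tape v)[j]? = some y := by
  have h1 : i < (tape u).length := by rw [length_tape]; exact Nat.lt_succ_of_le h.1
  have h2 : j < (tape v).length := by rw [length_tape]; exact Nat.lt_succ_of_le h.2
  exact ⟨_, _, List.getElem?_eq_getElem h1, List.getElem?_eq_getElem h2⟩

namespace ExitAutomaton

variable {α : Type*} {O Q : Type}

theorem next_iff_of_moves {M : ExitAutomaton α O Q} {q : Q} {T : Q ⊕ O → Prop} {d e : Move}
    (h : ∀ x y s d' e', M.step q x y s d' e' ↔ (T s ∧ d' = d ∧ e' = e)) {u v : List α} {i j : ℕ}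
    (hv : Valid u v i j) (s : Q ⊕ O) (i' j' : ℕ) :
    M.Next u v q i j s i' j' ↔ T s ∧ Valid u v i' j' ∧ Moves d e i j i' j' := by
  obtain ⟨x, y, hx, hy⟩ := hv.exists_symbols
  constructor
  · rintro ⟨hv', x, y, d, e, -, -, hs, hm⟩
    obtain ⟨hT, rfl, rfl⟩ := (h ..).1 hs
    exact ⟨hT, hv', hm⟩
  · rintro ⟨hT, hv', hm⟩
    exact ⟨hv', x, y, d, e, hx, hy, (h ..).2 ⟨hT, rfl, rfl⟩, hm⟩

theorem next_iff_of_stay {M : ExitAutomaton α O Q} {q : Q} {T : Q ⊕ O → Prop}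
    (h : ∀ x y s d' e', M.step q x y s d' e' ↔ (T s ∧ d' = Move.stay ∧ e' = Move.stay))
    {u v : List α} {i j : ℕ} (hv : Valid u v i j) (s : Q ⊕ O) (i' j' : ℕ) :
    M.Next u v q i j s i' j' ↔ T s ∧ i' = i ∧ j' = j := by
  rw [next_iff_of_moves h hv]
  simp only [Moves, Move.shift, add_zero, Nat.cast_inj]
  constructor
  · rintro ⟨h1, -, h2⟩; exact ⟨h1, h2⟩
  · rintro ⟨h1, rfl, rfl⟩; exact ⟨h1, hv, rfl, rfl⟩

theorem cond_iff_and {M : ExitAutomaton α O Q} {q : Q} {a b : Q ⊕ O}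
    (h : ∀ x y s d' e', M.step q x y s d' e' ↔ ((s = a ∨ s = b) ∧ d' = Move.stay ∧ e' = Move.stay))
    (hu : M.universal q) {u v : List α} {i j : ℕ} (hv : Valid u v i j)
    (Z : Q ⊕ O → ℕ → ℕ → Prop) : M.Cond u v Z q i j ↔ Z a i j ∧ Z b i j := by
  simp only [Cond, next_iff_of_stay h hv, hu, not_true_eq_false, false_and, or_false, true_and]
  constructor
  · exact fun h => ⟨h a i j ⟨Or.inl rfl, rfl, rfl⟩, h b i j ⟨Or.inr rfl, rfl, rfl⟩⟩
  · rintro ⟨ha, hb⟩ s i' j' ⟨rfl | rfl, rfl, rfl⟩ <;> assumption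

theorem cond_iff_or {M : ExitAutomaton α O Q} {q : Q} {a b : Q ⊕ O}
    (h : ∀ x y s d' e', M.step q x y s d' e' ↔ ((s = a ∨ s = b) ∧ d' = Move.stay ∧ e' = Move.stay))
    (hu : ¬ M.universal q) {u v : List α} {i j : ℕ} (hv : Valid u v i j)
    (Z : Q ⊕ O → ℕ → ℕ → Prop) : M.Cond u v Z q i j ↔ Z a i j ∨ Z b i j := by
  simp only [Cond, next_iff_of_stay h hv, hu, not_false_eq_true, false_and, false_or, true_and]
  constructor
  · rintro ⟨s, i', j', ⟨rfl | rfl, rfl, rfl⟩, hz⟩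
    exacts [Or.inl hz, Or.inr hz]
  · rintro (h | h)
    exacts [⟨a, i, j, ⟨Or.inl rfl, rfl, rfl⟩, h⟩, ⟨b, i, j, ⟨Or.inr rfl, rfl, rfl⟩, h⟩]

end ExitAutomaton

namespace Definable

variable {α : Type*} {Φ Ψ C : List α → List α → (ℕ → ℕ → Prop) → ℕ → ℕ → Prop}

theorem var : Definable fun (_ _ : List α) X i j => X i j := by
  let M : ExitAutomaton α Unit Unit :=
    { step := fun _ _ _ s d e => s = .inr () ∧ d = .stay ∧ e = .stay
      universal := fun _ => False }
  refine ⟨Unit, inferInstance, M, (), fun u v X i j hv => ?_⟩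
  have hn := M.next_iff_of_stay (q := ()) (T := fun s => s = .inr ()) (fun _ _ _ _ _ => Iff.rfl) hv
  rw [ExitAutomaton.acc_inl hv]
  simp [ExitAutomaton.Cond, hn, ExitAutomaton.acc_inr hv, M]

theorem top : Definable fun (_ _ : List α) _ _ _ => True := by
  let M : ExitAutomaton α Unit Unit :=
    { step := fun _ _ _ _ _ _ => False
      universal := fun _ => True }
  refine ⟨Unit, inferInstance, M, (), fun u v X i j hv => ?_⟩
  rw [ExitAutomaton.acc_inl hv]
  simp [ExitAutomaton.Cond, ExitAutomaton.Next, M]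

/-- Definable predicates are closed under tests of the scanned symbols. -/
theorem test (P : Option (TapeSymbol α) → Option (TapeSymbol α) → Prop) :
    Definable fun (u v : List α) _ i j => P (tape u)[i]? (tape v)[j]? := by
  let M : ExitAutomaton α Unit Unit :=
    { step := fun _ x y s d e => P (some x) (some y) ∧ s = .inr () ∧ d = .stay ∧ e = .stay
      universal := fun _ => False }
  refine (comp (fun _ : Unit => Definable.top) M ()).congr fun u v X i j hv => ?_
  rw [ExitAutomaton.acc_inl hv]
  obtain ⟨x, y, hx, hy⟩ := hv.exists_symbols
  rw [hx, hy]
  simp only [ExitAutomaton.Cond, M, false_and, not_false_eq_true, true_and, false_or]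
  constructor
  · intro h
    exact ⟨.inr (), i, j, ⟨hv, x, y, _, _, hx, hy, ⟨h, rfl, rfl, rfl⟩, by simp [Move.shift],
      by simp [Move.shift]⟩, (ExitAutomaton.acc_inr hv).2 trivial⟩
  · rintro ⟨s, i', j', ⟨-, x', y', d, e, hx', hy', h, -⟩, -⟩
    rw [hx] at hx'
    rw [hy] at hy'
    simp only [Option.some.injEq] at hx' hy'
    subst hx' hy'
    exact h.1

theorem and (hΦ : Definable Φ) (hΨ : Definable Ψ) :
    Definable fun u v X i j => Φ u v X i j ∧ Ψ u v X i j := by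
  let M : ExitAutomaton α Bool Unit :=
    { step := fun _ _ _ s d e => (s = .inr true ∨ s = .inr false) ∧ d = .stay ∧ e = .stay
      universal := fun _ => True }
  refine (comp (Φ := fun b => bif b then Φ else Ψ) (by rintro (_ | _) <;> assumption)
    M ()).congr fun u v X i j hv => ?_
  rw [ExitAutomaton.acc_inl hv, M.cond_iff_and (q := ()) (fun _ _ _ _ _ => Iff.rfl) trivial hv,
    ExitAutomaton.acc_inr hv, ExitAutomaton.acc_inr hv]
  rfl

theorem or (hΦ : Definable Φ) (hΨ : Definable Ψ) :
    Definable fun u v X i j => Φ u v X i j ∨ Ψ u v X i j := by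
  let M : ExitAutomaton α Bool Unit :=
    { step := fun _ _ _ s d e => (s = .inr true ∨ s = .inr false) ∧ d = .stay ∧ e = .stay
      universal := fun _ => False }
  refine (comp (Φ := fun b => bif b then Φ else Ψ) (by rintro (_ | _) <;> assumption)
    M ()).congr fun u v X i j hv => ?_
  rw [ExitAutomaton.acc_inl hv, M.cond_iff_or (q := ()) (fun _ _ _ _ _ => Iff.rfl) id hv,
    ExitAutomaton.acc_inr hv, ExitAutomaton.acc_inr hv]
  rfl

theorem exMove (d e : Move) (hΦ : Definable Φ) : Definable fun u v X i j =>
    ∃ i' j', Valid u v i' j' ∧ Moves d e i j i' j' ∧ Φ u v X i' j' := by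
  let M : ExitAutomaton α Unit Unit :=
    { step := fun _ _ _ s d' e' => s = .inr () ∧ d' = d ∧ e' = e
      universal := fun _ => False }
  refine (comp (fun _ : Unit => hΦ) M ()).congr fun u v X i j hv => ?_
  have hn := M.next_iff_of_moves (q := ()) (T := fun s => s = .inr ())
    (fun _ _ _ _ _ => Iff.rfl) hv
  rw [ExitAutomaton.acc_inl hv]
  simp only [ExitAutomaton.Cond, hn]
  constructor
  · rintro ⟨i', j', hv', hm, h⟩
    exact Or.inr ⟨id, _, i', j', ⟨rfl, hv', hm⟩, (ExitAutomaton.acc_inr hv').2 h⟩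
  · rintro (h | ⟨-, _, i', j', ⟨rfl, hv', hm⟩, h⟩)
    · exact h.1.elim
    · exact ⟨i', j', hv', hm, (ExitAutomaton.acc_inr (o := ()) hv').1 h⟩

theorem allMove (d e : Move) (hΦ : Definable Φ) : Definable fun u v X i j =>
    ∀ i' j', Valid u v i' j' → Moves d e i j i' j' → Φ u v X i' j' := by
  let M : ExitAutomaton α Unit Unit :=
    { step := fun _ _ _ s d' e' => s = .inr () ∧ d' = d ∧ e' = e
      universal := fun _ => True }
  refine (comp (fun _ : Unit => hΦ) M ()).congr fun u v X i j hv => ?_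
  have hn := M.next_iff_of_moves (q := ()) (T := fun s => s = .inr ())
    (fun _ _ _ _ _ => Iff.rfl) hv
  rw [ExitAutomaton.acc_inl hv]
  simp only [ExitAutomaton.Cond, hn]
  constructor
  · rintro h
    refine Or.inl ⟨trivial, ?_⟩
    rintro _ i' j' ⟨rfl, hv', hm⟩
    exact (ExitAutomaton.acc_inr hv').2 (h i' j' hv' hm)
  · rintro (⟨-, h⟩ | h)
    · intro i' j' hv' hm
      exact (ExitAutomaton.acc_inr (o := ()) hv').1 (h _ i' j' ⟨rfl, hv', hm⟩)
    · exact (h.1 trivial).elim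

/-- The automaton of a search along a direction: an exit `false`, guarded by an exit `true`. -/
def searchAutomaton (α : Type*) (d e : Move) (b : Prop) : ExitAutomaton α Bool (Fin 3) where
  step q _ _ s d' e' := match q with
    | 0 => (s = .inr false ∨ s = .inl 1) ∧ d' = .stay ∧ e' = .stay
    | 1 => (s = .inr true ∨ s = .inl 2) ∧ d' = .stay ∧ e' = .stay
    | 2 => s = .inl 0 ∧ d' = d ∧ e' = e
  universal q := match q with
    | 0 => b
    | 1 => ¬ b
    | 2 => b

/-- A predicate satisfying the recursion of an existential search is definable. -/
theorem exSearch (d e : Move) (hde : ¬ (d = Move.stay ∧ e = Move.stay)) (hΦ : Definable Φ)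
    (hΨ : Definable Ψ) (hC : ∀ u v X i j, Valid u v i j → (C u v X i j ↔ Φ u v X i j ∨
      (Ψ u v X i j ∧ ∃ i' j', Valid u v i' j' ∧ Moves d e i j i' j' ∧ C u v X i' j'))) :
    Definable C := by
  let M := searchAutomaton α d e False
  refine (comp (Φ := fun b => bif b then Ψ else Φ) (by rintro (_ | _) <;> assumption)
    M 0).congr fun u v X i j hv => ?_
  -- A search moves in one direction on a finite tape, so its recursion has a unique solution: `C`
  -- agrees with the automaton by induction on the distance left.
  obtain ⟨μ, hμ⟩ := Moves.exists_measure hde (u.length + 1) (v.length + 1)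
  induction hk : μ i j using Nat.strong_induction_on generalizing i j with
  | _ k ih =>
    subst hk
    rw [hC _ _ _ _ _ hv, ExitAutomaton.acc_inl hv]
    have h2 := M.next_iff_of_moves (q := 2) (fun _ _ _ _ _ => Iff.rfl) hv
    have u2 : M.universal 2 ↔ False := Iff.rfl
    have key : (∃ i' j', Valid u v i' j' ∧ Moves d e i j i' j' ∧ C u v X i' j') ↔
        M.Acc u v (fun o => (bif o then Ψ else Φ) u v X) (.inl 2) i j := by
      rw [ExitAutomaton.acc_inl hv]
      simp only [ExitAutomaton.Cond, h2, u2, false_and, false_or, not_false_eq_true, true_and]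
      constructor
      · rintro ⟨i', j', hv', hm, h⟩
        exact ⟨_, i', j', ⟨rfl, hv', hm⟩,
          (ih _ (hμ _ _ _ _ hv'.1 hv'.2 hm) i' j' hv' rfl).1 h⟩
      · rintro ⟨_, i', j', ⟨rfl, hv', hm⟩, h⟩
        exact ⟨i', j', hv', hm, (ih _ (hμ _ _ _ _ hv'.1 hv'.2 hm) i' j' hv' rfl).2 h⟩
    rw [key, M.cond_iff_or (q := 0) (fun _ _ _ _ _ => Iff.rfl) id hv, ExitAutomaton.acc_inr hv,
      ExitAutomaton.acc_inl (q := 1) hv,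
      M.cond_iff_and (q := 1) (fun _ _ _ _ _ => Iff.rfl) not_false hv, ExitAutomaton.acc_inr hv]
    rfl

/-- A predicate satisfying the recursion of a universal search is definable. -/
theorem allSearch (d e : Move) (hde : ¬ (d = Move.stay ∧ e = Move.stay)) (hΦ : Definable Φ)
    (hΨ : Definable Ψ) (hC : ∀ u v X i j, Valid u v i j → (C u v X i j ↔ Φ u v X i j ∧
      (Ψ u v X i j ∨ ∀ i' j', Valid u v i' j' → Moves d e i j i' j' → C u v X i' j'))) :
    Definable C := by
  let M := searchAutomaton α d e True
  refine (comp (Φ := fun b => bif b then Ψ else Φ) (by rintro (_ | _) <;> assumption)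
    M 0).congr fun u v X i j hv => ?_
  obtain ⟨μ, hμ⟩ := Moves.exists_measure hde (u.length + 1) (v.length + 1)
  induction hk : μ i j using Nat.strong_induction_on generalizing i j with
  | _ k ih =>
    subst hk
    rw [hC _ _ _ _ _ hv, ExitAutomaton.acc_inl hv]
    have h2 := M.next_iff_of_moves (q := 2) (fun _ _ _ _ _ => Iff.rfl) hv
    have u2 : M.universal 2 ↔ True := Iff.rfl
    have key : (∀ i' j', Valid u v i' j' → Moves d e i j i' j' → C u v X i' j') ↔
        M.Acc u v (fun o => (bif o then Ψ else Φ) u v X) (.inl 2) i j := by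
      rw [ExitAutomaton.acc_inl hv]
      simp only [ExitAutomaton.Cond, h2, u2, not_true_eq_false, false_and, or_false, true_and]
      constructor
      · rintro h _ i' j' ⟨rfl, hv', hm⟩
        exact (ih _ (hμ _ _ _ _ hv'.1 hv'.2 hm) i' j' hv' rfl).1 (h i' j' hv' hm)
      · rintro h i' j' hv' hm
        exact (ih _ (hμ _ _ _ _ hv'.1 hv'.2 hm) i' j' hv' rfl).2 (h _ i' j' ⟨rfl, hv', hm⟩)
    rw [key, M.cond_iff_and (q := 0) (fun _ _ _ _ _ => Iff.rfl) trivial hv, ExitAutomaton.acc_inr hv,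
      ExitAutomaton.acc_inl (q := 1) hv,
      M.cond_iff_or (q := 1) (fun _ _ _ _ _ => Iff.rfl) (not_not_intro trivial) hv, ExitAutomaton.acc_inr hv]
    rfl

end Definable

/-! ### Quantifiers over positions and the row test -/

/-- Exactly `i - 1` consecutive positions directly to the left of `j` satisfy `Z`. -/
def Row (Z : ℕ → Prop) (i j : ℕ) : Prop :=
  ∃ p, j = p + i ∧ 0 < i ∧ ¬ Z p ∧ ∀ l, p < l → l < j → Z l

/-- The nearest position to the left of `j` outside `Z` is unique, so it determines the row. -/
theorem row_iff {Z : ℕ → Prop} {p j : ℕ} (hp : p < j) (hZp : ¬ Z p)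
    (hZ : ∀ l, p < l → l < j → Z l) (i : ℕ) : Row Z i j ↔ j = p + i := by
  constructor
  · rintro ⟨q, hq, hi, hZq, hZ'⟩
    have h1 : ¬ p < q := fun h => hZq (hZ q h (by omega))
    have h2 : ¬ q < p := fun h => hZp (hZ' p h hp)
    omega
  · exact fun h => ⟨p, h, by omega, hZp, hZ⟩

namespace Definable

variable {α : Type*} {Φ Ψ : List α → List α → (ℕ → ℕ → Prop) → ℕ → ℕ → Prop}

theorem test₁ (P : Option (TapeSymbol α) → Prop) :
    Definable fun (u _ : List α) _ i _ => P (tape u)[i]? :=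
  test fun x _ => P x

theorem test₂ (P : Option (TapeSymbol α) → Prop) :
    Definable fun (_ v : List α) _ _ j => P (tape v)[j]? :=
  test fun _ y => P y

/-- `M` is a barrier: a position in `M` is still visited, but the scan does not go beyond it. In the
order game this keeps the second head in one part; with `M` false the scan covers everything to the
left. -/
theorem leftAll {M : List α → ℕ → Prop} (hM : Definable fun (_ v : List α) _ _ j => M v j)
    (hΦ : Definable Φ) : Definable fun u v X i j =>
      ∀ j', j' ≤ j → (∀ p, j' < p → p ≤ j → ¬ M v p) → Φ u v X i j' := by
  refine allSearch .stay .left (by simp) hΦ hM fun u v X i j hv => ⟨fun h => ⟨?_, ?_⟩, ?_⟩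
  · exact h j le_rfl fun p h1 h2 => by omega
  · refine or_iff_not_imp_left.2 fun hMj i' j' hv' hm j'' hj hp => ?_
    obtain ⟨h1, h2⟩ : i' = i ∧ j = j' + 1 := by
      simp [Moves, Move.shift] at hm; omega
    subst h1 h2
    refine h j'' (by omega) fun p hp1 hp2 => ?_
    rcases Nat.lt_or_ge j' p with h | h
    · rwa [show p = j' + 1 by omega]
    · exact hp p hp1 h
  · rintro ⟨h0, h⟩ j' hj hp
    rcases hj.eq_or_lt with rfl | hj
    · exact h0
    · refine (h.resolve_left (hp j hj le_rfl)) i (j - 1) ⟨hv.1, by have := hv.2; omega⟩ ?_ j'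
        (by omega) fun p h1 h2 => hp p h1 (by omega)
      simp [Moves, Move.shift]; omega

theorem rightAll (hΦ : Definable Φ) : Definable fun u v X i j =>
    ∀ j', j ≤ j' → j' ≤ v.length + 1 → Φ u v X i j' := by
  refine allSearch .stay .right (by simp) hΦ (test₁ fun _ => False)
    fun u v X i j hv => ⟨fun h => ⟨h j le_rfl hv.2, Or.inr fun i' j' hv' hm j'' h1 h2 => ?_⟩, ?_⟩
  · obtain ⟨rfl, rfl⟩ : i' = i ∧ j' = j + 1 := by
      simp [Moves, Move.shift] at hm; omega
    exact h j'' (by omega) h2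
  · rintro ⟨h0, h⟩ j' hj hl
    rcases hj.eq_or_lt with rfl | hj
    · exact h0
    · exact (h.resolve_left id) i (j + 1) ⟨hv.1, by omega⟩ (by simp [Moves, Move.shift]) j' hj hl

theorem leftEx (hΦ : Definable Φ) : Definable fun u v X i j => ∃ j', j' ≤ j ∧ Φ u v X i j' := by
  refine exSearch .stay .left (by simp) hΦ (test₁ fun _ => True)
    fun u v X i j hv => ⟨?_, ?_⟩
  · rintro ⟨j', hj, h⟩
    rcases hj.eq_or_lt with rfl | hj
    · exact Or.inl h
    · refine Or.inr ⟨trivial, i, j - 1, ⟨hv.1, by have := hv.2; omega⟩, ?_, j', by omega, h⟩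
      simp [Moves, Move.shift]; omega
  · rintro (h | ⟨-, i', j', hv', hm, j'', hj, h⟩)
    · exact ⟨j, le_rfl, h⟩
    · obtain ⟨rfl, rfl⟩ : i' = i ∧ j = j' + 1 := by
        simp [Moves, Move.shift] at hm; omega
      exact ⟨j'', by omega, h⟩

theorem rightEx {Z : List α → ℕ → Prop} (hZ : Definable fun (_ v : List α) _ _ j => Z v j)
    (hΦ : Definable Φ) : Definable fun u v X i j =>
      ∃ j', j ≤ j' ∧ j' ≤ v.length + 1 ∧ (∀ p, j ≤ p → p < j' → Z v p) ∧ Φ u v X i j' := by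
  refine exSearch .stay .right (by simp) hΦ hZ fun u v X i j hv => ⟨?_, ?_⟩
  · rintro ⟨j', hj, hl, hp, h⟩
    rcases hj.eq_or_lt with rfl | hj
    · exact Or.inl h
    · exact Or.inr ⟨hp j le_rfl hj, i, j + 1, ⟨hv.1, by omega⟩, by simp [Moves, Move.shift],
        j', hj, hl, fun p h1 h2 => hp p (by omega) h2, h⟩
  · rintro (h | ⟨hz, i', j', hv', hm, j'', hj, hl, hp, h⟩)
    · exact ⟨j, le_rfl, hv.2, fun p h1 h2 => by omega, h⟩
    · obtain ⟨rfl, rfl⟩ : i' = i ∧ j' = j + 1 := by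
        simp [Moves, Move.shift] at hm; omega
      refine ⟨j'', by omega, hl, fun p h1 h2 => ?_, h⟩
      rcases h1.eq_or_lt with rfl | h1
      · exact hz
      · exact hp p h1 h2

theorem diagEx (hΨ : Definable Ψ) (hΦ : Definable Φ) : Definable fun u v X i j =>
    ∃ k, Valid u v (i + k) (j + k) ∧ (∀ l, l < k → Ψ u v X (i + l) (j + l)) ∧
      Φ u v X (i + k) (j + k) := by
  refine exSearch .right .right (by simp) hΦ hΨ fun u v X i j hv => ⟨?_, ?_⟩
  · rintro ⟨k, hv', hl, h⟩
    rcases k with _ | k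
    · exact Or.inl h
    · refine Or.inr ⟨hl 0 (by omega), i + 1, j + 1, ⟨?_, ?_⟩, by simp [Moves, Move.shift], k, ?_,
        fun l hlk => ?_, ?_⟩
      · have := hv'.1; omega
      · have := hv'.2; omega
      · convert hv' using 1 <;> omega
      · convert hl (l + 1) (by omega) using 1 <;> omega
      · convert h using 1 <;> omega
  · rintro (h | ⟨hz, i', j', hv', hm, k, hvk, hl, h⟩)
    · exact ⟨0, hv, by simp, h⟩
    · obtain ⟨rfl, rfl⟩ : i' = i + 1 ∧ j' = j + 1 := by
        simp [Moves, Move.shift] at hm; omega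
      refine ⟨k + 1, ?_, fun l hlk => ?_, ?_⟩
      · convert hvk using 1 <;> omega
      · rcases l with _ | l
        · exact hz
        · convert hl l (by omega) using 1 <;> omega
      · convert h using 1 <;> omega

theorem all₂ (hΦ : Definable Φ) : Definable fun u v X i _ =>
    ∀ j, j ≤ v.length + 1 → Φ u v X i j := by
  refine ((leftAll (M := fun _ _ => False) (test₁ fun _ => False) hΦ).and (rightAll hΦ)).congr
    fun u v X i j hv => ⟨fun h => ⟨fun j' hj _ => h j' (hj.trans hv.2), fun j' _ hl => h j' hl⟩, ?_⟩
  rintro ⟨h1, h2⟩ j' hj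
  rcases le_total j' j with h | h
  · exact h1 j' h fun _ _ _ => id
  · exact h2 j' h hj

theorem ex₂ (hΦ : Definable Φ) : Definable fun u v X i _ =>
    ∃ j, j ≤ v.length + 1 ∧ Φ u v X i j := by
  refine ((leftEx hΦ).or (rightEx (Z := fun _ _ => True) (test₁ fun _ => True) hΦ)).congr
    fun u v X i j hv => ⟨?_, ?_⟩
  · rintro ⟨j', hj, h⟩
    rcases le_total j' j with hle | hle
    · exact Or.inl ⟨j', hle, h⟩
    · exact Or.inr ⟨j', hle, hj, fun _ _ _ => trivial, h⟩
  · rintro (⟨j', hj, h⟩ | ⟨j', -, hj, -, h⟩)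
    · exact ⟨j', hj.trans hv.2, h⟩
    · exact ⟨j', hj, h⟩

theorem all₁ (hΦ : Definable Φ) : Definable fun u v X _ j =>
    ∀ i, i ≤ u.length + 1 → Φ u v X i j := by
  have hl : Definable fun u v X i j => ∀ i', i' ≤ i → Φ u v X i' j := by
    refine allSearch .left .stay (by simp) hΦ (test₁ fun _ => False)
      fun u v X i j hv => ⟨fun h => ⟨h i le_rfl, Or.inr fun i' j' hv' hm i'' h1 => ?_⟩, ?_⟩
    · obtain ⟨h1, h2⟩ : i = i' + 1 ∧ j' = j := by
        simp [Moves, Move.shift] at hm; omega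
      subst h1 h2
      exact h i'' (by omega)
    · rintro ⟨h0, h⟩ i' hi
      rcases hi.eq_or_lt with rfl | hi
      · exact h0
      · refine (h.resolve_left id) (i - 1) j ⟨by have := hv.1; omega, hv.2⟩ ?_ i' (by omega)
        simp [Moves, Move.shift]; omega
  have hr : Definable fun u v X i j => ∀ i', i ≤ i' → i' ≤ u.length + 1 → Φ u v X i' j := by
    refine allSearch .right .stay (by simp) hΦ (test₁ fun _ => False)
      fun u v X i j hv => ⟨fun h => ⟨h i le_rfl hv.1, Or.inr fun i' j' hv' hm i'' h1 h2 => ?_⟩, ?_⟩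
    · obtain ⟨rfl, rfl⟩ : i' = i + 1 ∧ j' = j := by
        simp [Moves, Move.shift] at hm; omega
      exact h i'' (by omega) h2
    · rintro ⟨h0, h⟩ i' hi hl
      rcases hi.eq_or_lt with rfl | hi
      · exact h0
      · exact (h.resolve_left id) (i + 1) j ⟨by omega, hv.2⟩ (by simp [Moves, Move.shift]) i' hi hl
  refine (hl.and hr).congr fun u v X i j hv => ⟨fun h => ⟨fun i' hi => h i' (hi.trans hv.1),
    fun i' _ hi => h i' hi⟩, ?_⟩
  rintro ⟨h1, h2⟩ i' hi
  rcases le_total i' i with h | h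
  · exact h1 i' h
  · exact h2 i' h hi

section Row

variable {Z : List α → ℕ → Prop}

/-- The recursion of a scan in which both heads move left in lock step: the first head counts down
to the begin marker while the second passes over `Z`. Its negation is the recursion needed for
`allSearch`. -/
theorem exists_zeros_left_iff (u v : List α) {i j : ℕ} (hv : Valid u v i j) :
    (∃ p, j = p + i ∧ ¬ Z v p ∧ ∀ l, p < l → l ≤ j → Z v l) ↔
      (i = 0 ∧ ¬ Z v j) ∨ (Z v j ∧ ∃ i' j', Valid u v i' j' ∧ Moves .left .left i j i' j' ∧
        ∃ p, j' = p + i' ∧ ¬ Z v p ∧ ∀ l, p < l → l ≤ j' → Z v l) := by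
  constructor
  · rintro ⟨p, rfl, hp, hZ⟩
    rcases i with _ | i
    · exact Or.inl ⟨rfl, hp⟩
    · refine Or.inr ⟨hZ _ (by omega) le_rfl, i, p + i, ⟨?_, ?_⟩, ?_, p, rfl, hp,
        fun l h1 h2 => hZ l h1 (by omega)⟩
      · have := hv.1; omega
      · have := hv.2; omega
      · simp [Moves, Move.shift]; omega
  · rintro (⟨rfl, hZ⟩ | ⟨hZ, i', j', -, hm, p, rfl, hp, hl⟩)
    · exact ⟨j, rfl, hZ, fun l h1 h2 => by omega⟩
    · obtain ⟨rfl, rfl⟩ : i = i' + 1 ∧ j = p + (i' + 1) := by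
        simp [Moves, Move.shift] at hm; omega
      refine ⟨p, rfl, hp, fun l h1 h2 => ?_⟩
      rcases h2.eq_or_lt with rfl | h2
      · exact hZ
      · exact hl l h1 (by omega)

theorem row_iff_exists_moves (u v : List α) {i j : ℕ} (hv : Valid u v i j) :
    Row (Z v) i j ↔ ∃ i' j', Valid u v i' j' ∧ Moves .left .left i j i' j' ∧
      ∃ p, j' = p + i' ∧ ¬ Z v p ∧ ∀ l, p < l → l ≤ j' → Z v l := by
  constructor
  · rintro ⟨p, rfl, hi, hp, hZ⟩
    refine ⟨i - 1, p + (i - 1), ⟨?_, ?_⟩, ?_, p, rfl, hp, fun l h1 h2 => hZ l h1 (by omega)⟩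
    · have := hv.1; omega
    · have := hv.2; omega
    · simp [Moves, Move.shift]; omega
  · rintro ⟨i', j', -, hm, p, rfl, hp, hl⟩
    obtain ⟨rfl, rfl⟩ : i = i' + 1 ∧ j = p + (i' + 1) := by
      simp [Moves, Move.shift] at hm; omega
    exact ⟨p, rfl, by omega, hp, fun l h1 h2 => hl l h1 (by omega)⟩

theorem eq_zero : Definable fun (_ _ : List α) _ i _ => i = 0 :=
  (test₁ fun x => x = some TapeSymbol.beginMark).congr fun u _ _ _ _ _ =>
    (tape_getElem?_eq_beginMark u).symm

theorem ne_zero : Definable fun (_ _ : List α) _ i _ => i ≠ 0 :=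
  (test₁ fun x => x ≠ some TapeSymbol.beginMark).congr fun u _ _ _ _ _ =>
    not_congr (tape_getElem?_eq_beginMark u).symm

theorem row (hZ : Definable fun (_ v : List α) _ _ j => Z v j)
    (hZ' : Definable fun (_ v : List α) _ _ j => ¬ Z v j) :
    Definable fun (_ v : List α) _ i j => Row (Z v) i j :=
  (exMove .left .left (exSearch .left .left (by simp) (eq_zero.and hZ') hZ
    fun u v _ _ _ hv => exists_zeros_left_iff u v hv)).congr
    fun u v _ _ _ hv => row_iff_exists_moves u v hv

/-- Negation is not available as a closure operation, so the negated test is built from the dual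
search, which is sound because the scan always ends. -/
theorem not_row (hZ : Definable fun (_ v : List α) _ _ j => Z v j)
    (hZ' : Definable fun (_ v : List α) _ _ j => ¬ Z v j) :
    Definable fun (_ v : List α) _ i j => ¬ Row (Z v) i j := by
  have h : Definable fun (_ v : List α) _ i j =>
      ¬ ∃ p, j = p + i ∧ ¬ Z v p ∧ ∀ l, p < l → l ≤ j → Z v l := by
    refine allSearch .left .left (by simp) (ne_zero.or hZ) hZ' fun u v X i j hv => ?_
    rw [exists_zeros_left_iff u v hv, not_or, not_and_or, not_and_or, not_not]
    refine and_congr Iff.rfl (or_congr Iff.rfl ?_)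
    simp only [not_exists, not_and]
  refine (allMove .left .left h).congr fun u v X i j hv => ?_
  rw [row_iff_exists_moves u v hv]
  simp only [not_exists, not_and]

end Row

end Definable

/-! ### The order game -/

/-- A step of the order game: from the row `i` of a marked position to the row `i'` of a marked
position further to the left in the same part of the tape. -/
def Edge (Z O M : ℕ → Prop) (n i i' : ℕ) : Prop :=
  ∃ j, j ≤ n ∧ O j ∧ Row Z i j ∧ ∃ j', j' < j ∧ (∀ p, j' < p → p < j → ¬ M p) ∧ O j' ∧ Row Z i' j'

/-- Every play of the order game with rows up to `m` terminates. -/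
def Terminates (Z O M : ℕ → Prop) (m n : ℕ) : Prop :=
  ∀ S : ℕ → Prop, (∀ i, i ≤ m → (∀ i', i' ≤ m → Edge Z O M n i i' → S i') → S i) →
    ∀ i, i ≤ m → S i

theorem terminates_of_rank {Z O M : ℕ → Prop} {m n : ℕ} (ρ : ℕ → ℕ)
    (h : ∀ i i', Edge Z O M n i i' → ρ i' < ρ i) : Terminates Z O M m n := by
  intro S hS i
  induction hk : ρ i using Nat.strong_induction_on generalizing i with
  | _ k ih =>
    subst hk
    exact fun hi => hS i hi fun i' hi' he => ih _ (h i i' he) i' rfl hi'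

/-- The rows off the cycle satisfy the closure condition, so termination would force them to be all
rows. The case `i = i'` excludes loops. -/
theorem Terminates.not_edge {Z O M : ℕ → Prop} {m n : ℕ} (h : Terminates Z O M m n) {i i' : ℕ}
    (hi : i ≤ m) (hi' : i' ≤ m) (he : Edge Z O M n i i') : ¬ Edge Z O M n i' i := by
  intro he'
  refine (h (fun k => k ≠ i ∧ k ≠ i') (fun k _ hS => ⟨?_, ?_⟩) i hi).1 rfl
  · rintro rfl
    exact (hS i' hi' he).2 rfl
  · rintro rfl
    exact (hS i hi he').1 rfl

/-- Both marked positions and the new row are chosen universally, and a choice that is not an edge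
is accepted at once. The least fixed point makes infinite plays rejecting. -/
theorem Definable.terminates {α : Type*} {Z O M : List α → ℕ → Prop}
    (hZ : Definable fun (_ v : List α) _ _ j => Z v j)
    (hZ' : Definable fun (_ v : List α) _ _ j => ¬ Z v j)
    (hO : Definable fun (_ v : List α) _ _ j => ¬ O v j)
    (hM : Definable fun (_ v : List α) _ _ j => M v j) :
    Definable fun u v _ _ _ => Terminates (Z v) (O v) (M v) (u.length + 1) (v.length + 1) := by
  have h := ((all₂ ((hO.or (not_row hZ hZ')).or (allMove .stay .left (leftAll hM
    (hO.or (all₁ ((not_row hZ hZ').or var))))))).lfp).all₁.all₂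
  refine h.congr fun u v _ _ _ _ => ?_
  -- The fixed point ranges over pairs of head positions, the game over rows only. The leading
  -- quantifier over `j` forgets the second head, so the two operators agree once `X i j` means `S
  -- i`.
  have key : ∀ (X : ℕ → ℕ → Prop) (S : ℕ → Prop) (i : ℕ), i ≤ u.length + 1 →
      (∀ i j, Valid u v i j → (X i j ↔ S i)) →
      ((∀ j, j ≤ v.length + 1 → (¬ O v j ∨ ¬ Row (Z v) i j) ∨ ∀ i' j', Valid u v i' j' →
        Moves .stay .left i j i' j' → ∀ j'', j'' ≤ j' → (∀ p, j'' < p → p ≤ j' → ¬ M v p) →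
        ¬ O v j'' ∨ ∀ k, k ≤ u.length + 1 → ¬ Row (Z v) k j'' ∨ X k j'') ↔
      ∀ i', i' ≤ u.length + 1 → Edge (Z v) (O v) (M v) (v.length + 1) i i' → S i') := by
    intro X S i hi hXS
    constructor
    · rintro h i' hi' ⟨j, hj, hOj, hr, j', hlt, hMp, hOj', hr'⟩
      have h1 := (h j hj).resolve_left (by tauto) i (j - 1) ⟨hi, by omega⟩
        (by simp [Moves, Move.shift]; omega) j' (by omega) fun p h1 h2 => hMp p h1 (by omega)
      exact (hXS i' j' ⟨hi', by omega⟩).1 (((h1.resolve_left (by tauto)) i' hi').resolve_left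
        (by tauto))
    · intro h j hj
      by_cases hOj : O v j
      · by_cases hr : Row (Z v) i j
        · refine Or.inr fun i' j' hv' hm j'' hle hMp => ?_
          obtain ⟨h1, h2⟩ : i' = i ∧ j = j' + 1 := by
            simp [Moves, Move.shift] at hm; omega
          subst h1 h2
          refine or_iff_not_imp_left.2 fun hO' k hk => or_iff_not_imp_left.2 fun hr' => ?_
          rw [not_not] at hO' hr'
          exact (hXS _ _ ⟨hk, by omega⟩).2 (h k hk ⟨j' + 1, hj, hOj, hr, j'', by omega,
            fun p h1 h2 => hMp p h1 (by omega), hO', hr'⟩)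
        · exact Or.inl (Or.inr hr)
      · exact Or.inl (Or.inl hOj)
  constructor
  · intro h j hj i hi X hX
    refine h (fun i => ∀ j, j ≤ v.length + 1 → X i j) (fun i hi hS j hj => hX i j ⟨hi, hj⟩ ?_)
      i hi j hj
    have := (key (fun i _ => ∀ j, j ≤ v.length + 1 → X i j) _ i hi fun _ _ _ => Iff.rfl).2 hS
    intro j hj
    refine (this j hj).imp_right fun h i' j' hv hm j'' hle hMp => ?_
    refine (h i' j' hv hm j'' hle hMp).imp_right fun h k hk => (h k hk).imp_right fun h => h j'' ?_
    have := hv.2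
    omega
  · intro h S hS i hi
    exact h 0 (Nat.zero_le _) i hi (fun i _ => S i) fun i j hv hX => hS i hv.1
      ((key (fun i _ => S i) S i hv.1 fun _ _ _ => Iff.rfl).1 hX)

/-- Two enumerations of `Fin n` in which no two values occur in opposite orders are equal. -/
theorem perm_eq_of_forall_not_reversed {n : ℕ} (σ τ : Equiv.Perm (Fin n))
    (h : ∀ r' r q' q, r' < r → q' < q → σ r = τ q' → σ r' ≠ τ q) : σ = τ := by
  have hmono : StrictMono (σ.trans τ.symm) := by
    intro r' r hr
    refine lt_of_not_ge fun hle => ?_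
    rcases hle.eq_or_lt with heq | hlt
    · exact hr.ne' ((σ.trans τ.symm).injective heq)
    · exact h r' r _ _ hr hlt (by simp) (by simp)
  -- A finite linear order has no automorphism other than the identity.
  have hid : (σ.trans τ.symm) = Equiv.refl _ := by
    have := Subsingleton.elim (hmono.orderIsoOfSurjective _ (σ.trans τ.symm).surjective)
      (OrderIso.refl (Fin n))
    ext r : 1
    exact congrArg (fun e : Fin n ≃o Fin n => e r) this
  ext r : 1
  have := congrArg (fun e : Equiv.Perm (Fin n) => τ (e r)) hid
  simpa using this

/-- The order game on a tape with two parts, in which the marked positions `p r` and `q r` carry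
the rows `σ r + c` and `τ r + c`, terminates if and only if `σ = τ`. -/
theorem terminates_iff_perm_eq {n m L c : ℕ} {Z O M : ℕ → Prop} (σ τ : Equiv.Perm (Fin n))
    (p q : Fin n → ℕ) (hp : StrictMono p) (hq : StrictMono q) (hpL : ∀ r, p r ≤ L)
    (hqL : ∀ r, q r ≤ L) (hO : ∀ j, j ≤ L → (O j ↔ (∃ r, j = p r) ∨ ∃ r, j = q r))
    (hpR : ∀ r i, Row Z i (p r) ↔ i = σ r + c) (hqR : ∀ r i, Row Z i (q r) ↔ i = τ r + c)
    (hpq : ∀ r r', ∃ x, p r < x ∧ x < q r' ∧ M x)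
    (hpM : ∀ r' r x, p r' < x → x < p r → ¬ M x) (hqM : ∀ r' r x, q r' < x → x < q r → ¬ M x)
    (hm : ∀ k : Fin n, (k : ℕ) + c ≤ m) : Terminates Z O M m L ↔ σ = τ := by
  constructor
  · intro h
    -- A reversed pair gives edges in both directions between two rows, one from each part.
    refine perm_eq_of_forall_not_reversed σ τ fun r' r q' s hr hs h1 h2 => ?_
    have e1 : Edge Z O M L (σ r + c) (σ r' + c) := ⟨p r, hpL r, (hO _ (hpL r)).2 (Or.inl ⟨r, rfl⟩),
      (hpR _ _).2 rfl, p r', hp hr, hpM r' r, (hO _ (hpL r')).2 (Or.inl ⟨r', rfl⟩),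
      (hpR _ _).2 rfl⟩
    have e2 : Edge Z O M L (τ s + c) (τ q' + c) := ⟨q s, hqL s, (hO _ (hqL s)).2 (Or.inr ⟨s, rfl⟩),
      (hqR _ _).2 rfl, q q', hq hs, hqM q' s, (hO _ (hqL q')).2 (Or.inr ⟨q', rfl⟩),
      (hqR _ _).2 rfl⟩
    rw [← h1, ← h2] at e2
    exact h.not_edge (hm _) (hm _) e1 e2
  · rintro rfl
    -- The rank of a row is its place in the common enumeration; numbers outside the range lie on no
    -- edge, so their value is immaterial.
    refine terminates_of_rank (fun i => if h : i - c < n then (σ.symm ⟨i - c, h⟩ : ℕ) else 0) ?_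
    have hlt : ∀ r' r : Fin n, r' < r → ∀ i i', i = σ r + c → i' = σ r' + c →
        (if h : i' - c < n then (σ.symm ⟨i' - c, h⟩ : ℕ) else 0) <
        if h : i - c < n then (σ.symm ⟨i - c, h⟩ : ℕ) else 0 := by
      rintro r' r hr _ _ rfl rfl
      simpa using hr
    rintro i i' ⟨j, hj, hOj, hr, j', hlt', hMp, hOj', hr'⟩
    rcases (hO j hj).1 hOj with ⟨r, rfl⟩ | ⟨r, rfl⟩ <;>
    rcases (hO j' (by omega)).1 hOj' with ⟨r', rfl⟩ | ⟨r', rfl⟩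
    · exact hlt r' r (hp.lt_iff_lt.1 hlt') _ _ ((hpR _ _).1 hr) ((hpR _ _).1 hr')
    · obtain ⟨x, h1, h2, -⟩ := hpq r r'
      omega
    · obtain ⟨x, h1, h2, h3⟩ := hpq r' r
      exact absurd h3 (hMp x h1 h2)
    · exact hlt r' r (hq.lt_iff_lt.1 hlt') _ _ ((hqR _ _).1 hr) ((hqR _ _).1 hr')

/-! ### Block coordinates and pairs of permutations -/

theorem mul_add_lt_mul_add {K r r' k k' : ℕ} (hr : r' < r) (hk : k' < K) :
    r' * K + k' < r * K + k := by
  have := Nat.mul_le_mul_right K (Nat.succ_le_of_lt hr)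
  rw [Nat.succ_mul] at this
  omega

theorem exists_mul_add {K : ℕ} (hK : 0 < K) (j : ℕ) : ∃ r k, k < K ∧ j = r * K + k :=
  ⟨j / K, j % K, Nat.mod_lt _ hK, by rw [mul_comm]; exact (Nat.div_add_mod j K).symm⟩

theorem le_of_mul_add_lt {K r r' k k' : ℕ} (hk : k < K) (h : r' * K + k' < r * K + k) :
    r' ≤ r := by
  by_contra hc
  have := mul_add_lt_mul_add (k := k') (not_le.1 hc) hk
  omega

/-- The sequence consisting of the values of `σ` and, from the index `h` on, those of `τ`. -/
def combine {n : ℕ} (h : ℕ) (σ τ : Equiv.Perm (Fin n)) (r : ℕ) : ℕ :=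
  if hr : r < n then σ ⟨r, hr⟩ else if hr : r - h < n then τ ⟨r - h, hr⟩ else 0

theorem combine_left {n h : ℕ} (σ τ : Equiv.Perm (Fin n)) (r : Fin n) :
    combine h σ τ r = σ r := by
  simp [combine]

theorem combine_right {n h : ℕ} (hn : n ≤ h) (σ τ : Equiv.Perm (Fin n)) (r : Fin n) :
    combine h σ τ (h + r) = τ r := by
  have : ¬ h + r < n := by omega
  simp [combine, this]

theorem combine_congr_left {n h : ℕ} (σ τ τ' : Equiv.Perm (Fin n)) {r : ℕ} (hr : r < n) :
    combine h σ τ r = combine h σ τ' r := by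
  simp [combine, hr]

theorem combine_congr_right {n h : ℕ} (σ σ' τ : Equiv.Perm (Fin n)) {r : ℕ} (hr : n ≤ r) :
    combine h σ τ r = combine h σ' τ r := by
  simp [combine, not_lt.2 hr]

theorem combine_lt {n h : ℕ} (hn : 0 < n) (σ τ : Equiv.Perm (Fin n)) (r : ℕ) :
    combine h σ τ r < n := by
  unfold combine
  split_ifs
  exacts [Fin.is_lt _, Fin.is_lt _, hn]

/-! ### The binary code, for alphabets with at least two letters -/

section Binary

variable {α : Type*} (a b : α)

/-- The letter at tape position `r * (n + 4) + k` of the binary code of two permutations is `b`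
rather than `a`. -/
def IsMark (n : ℕ) (c : ℕ → ℕ) (r k : ℕ) : Prop := r = n ∨ k = 0 ∨ k = c r + 2 ∨ k = n + 3

open Classical in
/-- The binary code of two permutations: blocks `a ⋯ a b a ⋯ a b b` of length `n + 4`, where the
position of the isolated letter `b` shows the value, with a block of letters `b` between those of
the first and those of the second permutation. -/
noncomputable def binaryWord (n : ℕ) (σ τ : Equiv.Perm (Fin n)) : List α :=
  -- The begin marker takes the place of offset `0` of block `0`; hence one letter less, and the
  -- letter with index `x` at tape position `x + 1`.
  (List.range ((2 * n + 1) * (n + 4) - 1)).map fun x =>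
    if IsMark n (combine (n + 1) σ τ) ((x + 1) / (n + 4)) ((x + 1) % (n + 4)) then b else a

theorem length_binaryWord (n : ℕ) (σ τ : Equiv.Perm (Fin n)) :
    (binaryWord a b n σ τ).length = (2 * n + 1) * (n + 4) - 1 := by
  simp [binaryWord]

open Classical in
theorem tape_binaryWord (n : ℕ) (σ τ : Equiv.Perm (Fin n)) {r k : ℕ} (hr : r < 2 * n + 1)
    (hk : k < n + 4) (h0 : 0 < r ∨ 0 < k) : (tape (binaryWord a b n σ τ))[r * (n + 4) + k]? =
      some (.letter (if IsMark n (combine (n + 1) σ τ) r k then b else a)) := by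
  have hpos : 0 < r * (n + 4) + k := by
    rcases h0 with h | h
    · have := Nat.mul_pos h (show 0 < n + 4 by omega); omega
    · omega
  have hlt := mul_add_lt_mul_add (k := 0) hr hk
  obtain ⟨x, hx⟩ : ∃ x, r * (n + 4) + k = x + 1 := ⟨r * (n + 4) + k - 1, by omega⟩
  have hxl : x < (binaryWord a b n σ τ).length := by rw [length_binaryWord]; omega
  rw [hx, tape_getElem?_succ _ hxl]
  have hdiv : (x + 1) / (n + 4) = r := by
    rw [← hx, mul_comm, Nat.mul_add_div (by omega), Nat.div_eq_of_lt hk, add_zero]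
  have hmod : (x + 1) % (n + 4) = k := by
    rw [← hx, mul_comm, Nat.mul_add_mod, Nat.mod_eq_of_lt hk]
  simp only [binaryWord, List.getElem_map, List.getElem_range, hdiv, hmod]

/-- Block `n` is the separator and carries no value, so the sequences may differ there. -/
theorem getElem?_binaryWord_congr {n p : ℕ} (σ τ σ' τ' : Equiv.Perm (Fin n))
    (h : (p + 1) / (n + 4) ≠ n → combine (n + 1) σ τ ((p + 1) / (n + 4)) =
      combine (n + 1) σ' τ' ((p + 1) / (n + 4))) :
    (binaryWord a b n σ τ)[p]? = (binaryWord a b n σ' τ')[p]? := by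
  have hmark : IsMark n (combine (n + 1) σ τ) ((p + 1) / (n + 4)) ((p + 1) % (n + 4)) ↔
      IsMark n (combine (n + 1) σ' τ') ((p + 1) / (n + 4)) ((p + 1) % (n + 4)) := by
    by_cases hn : (p + 1) / (n + 4) = n
    · exact ⟨fun _ => Or.inl hn, fun _ => Or.inl hn⟩
    · simp only [IsMark, h hn]
  simp only [binaryWord, List.getElem?_map]
  by_cases hp : p < (2 * n + 1) * (n + 4) - 1
  · simp only [List.getElem?_range hp, Option.map_some, Option.some.injEq]
    split_ifs <;> simp_all
  · simp [hp]

/-- The letter at position `j` is `a`. -/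
def LetterAt (a : α) (v : List α) (j : ℕ) : Prop := (tape v)[j]? = some (.letter a)

/-- The letter `b` at position `j` is isolated between two letters `a`. -/
def IsolatedAt (v : List α) (j : ℕ) : Prop :=
  LetterAt b v j ∧ LetterAt a v (j - 1) ∧ LetterAt a v (j + 1)

/-- The letter `b` at position `j` is surrounded by letters `b`. -/
def InnerAt (v : List α) (j : ℕ) : Prop :=
  LetterAt b v j ∧ LetterAt b v (j - 1) ∧ LetterAt b v (j + 1)

variable {a b}

theorem LetterAt.bounds {v : List α} {j : ℕ} (h : LetterAt a v j) : 0 < j ∧ j ≤ v.length := by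
  constructor
  · rcases j with _ | j
    · simp [LetterAt, tape] at h
    · omega
  · by_contra hc
    rcases (show v.length + 1 ≤ j by omega).eq_or_lt with rfl | hlt
    · simp [LetterAt, tape_getElem?_length] at h
    · rw [LetterAt, List.getElem?_eq_none (by rw [length_tape]; omega)] at h
      simp at h

theorem definable_letterAt (a : α) : Definable fun (_ v : List α) _ _ j => LetterAt a v j :=
  Definable.test₂ fun y => y = some (.letter a)

theorem definable_not_letterAt (a : α) :
    Definable fun (_ v : List α) _ _ j => ¬ LetterAt a v j :=
  Definable.test₂ fun y => ¬ y = some (.letter a)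

theorem definable_not_isolatedAt (a b : α) :
    Definable fun (_ v : List α) _ _ j => ¬ IsolatedAt a b v j := by
  refine ((definable_not_letterAt b).or (((definable_not_letterAt a).allMove .stay .left).or
    ((definable_not_letterAt a).allMove .stay .right))).congr fun u v X i j hv => ?_
  constructor
  · intro h
    by_cases hb : LetterAt b v j
    · by_cases ha : LetterAt a v (j - 1)
      · refine Or.inr (Or.inr fun i' j' _ hm ha' => h ⟨hb, ha, ?_⟩)
        rwa [show j + 1 = j' by simp [Moves, Move.shift] at hm; omega]
      · refine Or.inr (Or.inl fun i' j' _ hm ha' => ha ?_)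
        rwa [show j - 1 = j' by simp [Moves, Move.shift] at hm; omega]
    · exact Or.inl hb
  · rintro h ⟨hb, ha, ha'⟩
    have := hb.bounds
    rcases h with h | h | h
    · exact h hb
    · exact h i (j - 1) ⟨hv.1, by omega⟩ (by simp [Moves, Move.shift]; omega) ha
    · exact h i (j + 1) ⟨hv.1, by omega⟩ (by simp [Moves, Move.shift]) ha'

theorem definable_innerAt (b : α) : Definable fun (_ v : List α) _ _ j => InnerAt b v j := by
  refine ((definable_letterAt b).and (((definable_letterAt b).exMove .stay .left).and
    ((definable_letterAt b).exMove .stay .right))).congr fun u v X i j hv => ?_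
  constructor
  · rintro ⟨h, h1, h2⟩
    have := h.bounds
    exact ⟨h, ⟨i, j - 1, ⟨hv.1, by omega⟩, by simp [Moves, Move.shift]; omega, h1⟩,
      ⟨i, j + 1, ⟨hv.1, by omega⟩, by simp [Moves, Move.shift], h2⟩⟩
  · rintro ⟨h, ⟨i', j', -, hm, h1⟩, ⟨i'', j'', -, hm', h2⟩⟩
    refine ⟨h, ?_, ?_⟩
    · rwa [show j - 1 = j' by simp [Moves, Move.shift] at hm; omega]
    · rwa [show j + 1 = j'' by simp [Moves, Move.shift] at hm'; omega]

theorem terminates_binaryWord_iff (hab : a ≠ b) {n : ℕ} (hn : 0 < n) (σ τ : Equiv.Perm (Fin n)) :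
    Terminates (LetterAt a (binaryWord a b n σ τ)) (IsolatedAt a b (binaryWord a b n σ τ))
      (InnerAt b (binaryWord a b n σ τ)) (n + 1) ((binaryWord a b n σ τ).length + 1) ↔ σ = τ := by
  set v := binaryWord a b n σ τ with hv
  set c := combine (n + 1) σ τ with hc
  have hcn : ∀ r, c r < n := combine_lt hn σ τ
  have hlen : v.length + 1 = (2 * n + 1) * (n + 4) := by
    rw [hv, length_binaryWord]
    have := Nat.mul_pos (show 0 < 2 * n + 1 by omega) (show 0 < n + 4 by omega)
    omega
  have hA : ∀ r k, r < 2 * n + 1 → k < n + 4 →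
      (LetterAt a v (r * (n + 4) + k) ↔ ¬ IsMark n c r k) := by
    intro r k hr hk
    by_cases h0 : 0 < r ∨ 0 < k
    · rw [LetterAt, hv, tape_binaryWord a b n σ τ hr hk h0, ← hc]
      split_ifs with h <;> simp [h, hab.symm]
    · obtain ⟨rfl, rfl⟩ : r = 0 ∧ k = 0 := by omega
      simp [LetterAt, IsMark, tape]
  have hB : ∀ r k, r < 2 * n + 1 → k < n + 4 →
      (LetterAt b v (r * (n + 4) + k) ↔ (0 < r ∨ 0 < k) ∧ IsMark n c r k) := by
    intro r k hr hk
    by_cases h0 : 0 < r ∨ 0 < k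
    · rw [LetterAt, hv, tape_binaryWord a b n σ τ hr hk h0, ← hc]
      split_ifs with h <;> simp [h, hab, h0]
    · obtain ⟨rfl, rfl⟩ : r = 0 ∧ k = 0 := by omega
      simp [LetterAt, tape]
  have hlt : ∀ r k, k < n + 4 → r * (n + 4) + k ≤ v.length → r < 2 * n + 1 := by
    intro r k hk h
    by_contra hr
    have := Nat.mul_le_mul_right (n + 4) (not_lt.1 hr)
    omega
  have hlast : ∀ r, ¬ LetterAt a v (r * (n + 4)) := by
    intro r h
    have := hlt r 0 (by omega) h.bounds.2
    exact (hA r 0 this (by omega)).1 h (Or.inr (Or.inl rfl))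
  -- The offset `c r + 2` lies between `2` and `n + 1`, so both of its neighbours are interior
  -- letters `a`; at the block borders some neighbour is a `b` or a marker.
  have hO : ∀ r k, r < 2 * n + 1 → k < n + 4 →
      (IsolatedAt a b v (r * (n + 4) + k) ↔ r ≠ n ∧ k = c r + 2) := by
    intro r k hr hk
    have hcr := hcn r
    by_cases h1 : k = 0
    · subst h1
      constructor
      · rintro ⟨h, h', -⟩
        obtain ⟨s, rfl⟩ : ∃ s, r = s + 1 :=
          ⟨r - 1, by have := ((hB r 0 hr hk).1 h).1; omega⟩
        rw [Nat.succ_mul, show s * (n + 4) + (n + 4) + 0 - 1 = s * (n + 4) + (n + 3) by omega,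
          hA s (n + 3) (by omega) (by omega)] at h'
        exact absurd (Or.inr (Or.inr (Or.inr rfl))) h'
      · rintro ⟨-, h⟩; omega
    · by_cases h2 : k = n + 3
      · subst h2
        constructor
        · rintro ⟨-, -, h⟩
          rw [add_assoc, ← Nat.succ_mul] at h
          exact absurd h (hlast _)
        · rintro ⟨-, h⟩; omega
      · have e1 : r * (n + 4) + k - 1 = r * (n + 4) + (k - 1) := by omega
        rw [IsolatedAt, e1, add_assoc, hA r _ hr (by omega), hA r _ hr (by omega), hB r _ hr hk]
        simp only [IsMark]
        omega
  -- Outside the middle block each `b` has a neighbour other than `b`: the right one at offset `0`,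
  -- the left one elsewhere.
  have hM : ∀ r k, r < 2 * n + 1 → k < n + 4 → r ≠ n → ¬ InnerAt b v (r * (n + 4) + k) := by
    rintro r k hr hk hrn ⟨h, h1, h2⟩
    have hcr := hcn r
    rcases ((hB r k hr hk).1 h).2 with h | rfl | rfl | rfl
    · exact hrn h
    · rw [add_assoc, hB r _ hr (by omega)] at h2
      simp only [IsMark] at h2
      omega
    · rw [show r * (n + 4) + (c r + 2) - 1 = r * (n + 4) + (c r + 1) by omega,
        hB r _ hr (by omega)] at h1
      simp only [IsMark] at h1
      omega
    · rw [show r * (n + 4) + (n + 3) - 1 = r * (n + 4) + (n + 2) by omega,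
        hB r _ hr (by omega)] at h1
      simp only [IsMark] at h1
      omega
  have hrow : ∀ r i, r < 2 * n + 1 → r ≠ n →
      (Row (LetterAt a v) i (r * (n + 4) + (c r + 2)) ↔ i = c r + 2) := by
    intro r i hr hrn
    have hcr := hcn r
    rw [row_iff (p := r * (n + 4)) (by omega) (hlast r) (fun l h1 h2 => ?_)]
    · omega
    · obtain ⟨k, rfl⟩ := Nat.exists_eq_add_of_le h1.le
      rw [hA r k hr (by omega)]
      simp only [IsMark]
      omega
  have hl : ∀ r : Fin n, c r = σ r := fun r => combine_left σ τ r
  have hr : ∀ r : Fin n, c (n + 1 + r) = τ r := fun r => combine_right (by omega) σ τ r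
  have hsep : ∀ r' k' r k x, k' < n + 4 → k < n + 4 → (r < n ∨ n < r') → r < 2 * n + 1 →
      r' * (n + 4) + k' < x → x < r * (n + 4) + k → ¬ InnerAt b v x := by
    intro r' k' r k x hk' hk h hr h1 h2
    obtain ⟨s, l, hl, rfl⟩ := exists_mul_add (show 0 < n + 4 by omega) x
    have := le_of_mul_add_lt hl h1
    have := le_of_mul_add_lt hk h2
    exact hM s l (by omega) hl (by omega)
  have hpos : ∀ r k, r < 2 * n + 1 → k < n + 4 → r * (n + 4) + k ≤ v.length + 1 := by
    intro r k hr hk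
    rw [hlen]
    exact (mul_add_lt_mul_add (k := 0) hr hk).le
  have hσ : ∀ r : Fin n, (σ r : ℕ) + 2 < n + 4 := fun r => by have := (σ r).is_lt; omega
  have hτ : ∀ r : Fin n, (τ r : ℕ) + 2 < n + 4 := fun r => by have := (τ r).is_lt; omega
  refine terminates_iff_perm_eq (c := 2) σ τ (fun r => r * (n + 4) + (σ r + 2))
    (fun r => (n + 1 + r) * (n + 4) + (τ r + 2)) ?_ ?_ ?_ ?_ ?_ ?_ ?_ ?_ ?_ ?_ ?_
  · exact fun r' r h => mul_add_lt_mul_add h (hσ r')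
  · exact fun r' r h => mul_add_lt_mul_add (by simpa using h) (hτ r')
  · exact fun r => hpos _ _ (by omega) (hσ r)
  · exact fun r => hpos _ _ (by omega) (hτ r)
  · intro j hj
    obtain ⟨r, k, hk, rfl⟩ := exists_mul_add (show 0 < n + 4 by omega) j
    constructor
    · intro h
      have hr' := hlt r k hk h.1.bounds.2
      obtain ⟨hrn, rfl⟩ := (hO r k hr' hk).1 h
      rcases lt_or_gt_of_ne hrn with h | h
      · exact Or.inl ⟨⟨r, h⟩, by rw [← hl]⟩
      · refine Or.inr ⟨⟨r - (n + 1), by omega⟩, ?_⟩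
        rw [← hr]
        simp only [show n + 1 + (r - (n + 1)) = r by omega]
    · rintro (⟨s, hs⟩ | ⟨s, hs⟩)
      · rw [hs, hO _ _ (by omega) (hσ s)]
        exact ⟨by omega, by rw [hl]⟩
      · rw [hs, hO _ _ (by omega) (hτ s)]
        exact ⟨by omega, by rw [hr]⟩
  · intro r i
    have := hrow r i (by omega) (by omega)
    rwa [hl] at this
  · intro r i
    have := hrow (n + 1 + r) i (by omega) (by omega)
    rwa [hr] at this
  · intro r r'
    -- The offsets `0`, `1`, `2` of the middle block all carry `b`.
    refine ⟨n * (n + 4) + 1, mul_add_lt_mul_add r.is_lt (hσ r), mul_add_lt_mul_add (by omega)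
      (by omega), ?_, ?_, ?_⟩
    · exact (hB n 1 (by omega) (by omega)).2 ⟨by omega, Or.inl rfl⟩
    · exact (hB n 0 (by omega) (by omega)).2 ⟨by omega, Or.inl rfl⟩
    · exact (hB n 2 (by omega) (by omega)).2 ⟨by omega, Or.inl rfl⟩
  · exact fun r' r x h1 h2 => hsep _ _ _ _ x (hσ r') (hσ r) (Or.inl r.is_lt) (by omega) h1 h2
  · exact fun r' r x h1 h2 => hsep _ _ _ _ x (hτ r') (hτ r) (Or.inr (by omega)) (by omega) h1 h2
  · intro k; omega

theorem exists_recognizable_not_recognizable_compl (α : Type*) [Nontrivial α] :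
    ∃ R : Set (List α × List α), Recognizable R ∧ ¬ Recognizable Rᶜ := by
  obtain ⟨a, b, hab⟩ := exists_pair_ne α
  -- The relation consists of all pairs whose order game terminates. Only its values on codes
  -- matter, so the shape of the input need not be tested.
  refine ⟨_, (Definable.terminates (definable_letterAt a) (definable_not_letterAt a)
    (definable_not_isolatedAt a b) (definable_innerAt b)).recognizable, ?_⟩
  refine not_recognizable_compl _ (fun n => List.replicate n a) (by simp) (binaryWord a b)
    -- The cut lies in the middle block, which is common to all codes.
    (fun n => n * (n + 4)) (by simp [length_binaryWord]) ?_ ?_ ?_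
  · refine fun n σ τ p hp => getElem?_binaryWord_congr a b σ τ σ σ fun hne => ?_
    refine combine_congr_left σ τ σ (lt_of_le_of_ne (Nat.le_of_lt_succ ?_) hne)
    exact (Nat.div_lt_iff_lt_mul (by omega)).2 (by rw [Nat.succ_mul]; omega)
  · refine fun n σ τ p hp => getElem?_binaryWord_congr a b σ τ τ τ fun hne => ?_
    refine combine_congr_right σ τ τ ((Nat.le_div_iff_mul_le (by omega)).2 (by omega))
  · intro n hn σ τ
    simpa using terminates_binaryWord_iff hab hn σ τ

end Binary

/-! ### The code by columns of permutation matrices -/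

theorem getElem?_flatten_of_length {β : Type*} {K : ℕ} {L : List (List β)}
    (hL : ∀ l ∈ L, l.length = K) (r : ℕ) {k : ℕ} (hk : k < K) :
    L.flatten[r * K + k]? = L[r]?.bind (·[k]?) := by
  induction L generalizing r with
  | nil => simp
  | cons l L ih =>
    have hl : l.length = K := hL l (by simp)
    rcases r with _ | r
    · simp [List.getElem?_append_left (show k < l.length by omega)]
    · rw [List.flatten_cons, List.getElem?_append_right (by rw [hl, Nat.succ_mul]; omega), hl,
        show (r + 1) * K + k - K = r * K + k by rw [Nat.succ_mul]; omega,
        ih fun l' h => hL l' (by simp [h])]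
      simp

/-- One more separator at the end gives all blocks the same length, and letters can be located by
division with remainder. -/
theorem intercalate_append_self {β : Type*} (s : List β) {L : List (List β)} (hL : L ≠ []) :
    List.intercalate s L ++ s = (L.map (· ++ s)).flatten := by
  induction L with
  | nil => exact absurd rfl hL
  | cons l L ih =>
    rcases L with _ | ⟨l', L⟩
    · simp [List.intercalate]
    · have := ih (by simp)
      simp only [List.intercalate, List.intersperse_cons_cons, List.flatten_cons, List.map_cons,
        List.append_assoc] at this ⊢
      rw [this]

section PermWord

variable {n : ℕ} (σ : Equiv.Perm (Fin n))

theorem permWord_append_hash (hn : 0 < n) : permWord σ ++ [Letter.hash] =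
    (List.ofFn fun r => permColumn σ r ++ [Letter.hash]).flatten := by
  rw [permWord, intercalate_append_self _ (by simp; omega), List.map_ofFn]
  rfl

theorem length_permWord (hn : 0 < n) : (permWord σ).length + 1 = n * (n + 1) := by
  have := congrArg List.length (permWord_append_hash σ hn)
  simpa [List.length_flatten, List.map_ofFn, Function.comp_def, permColumn, List.sum_ofFn]
    using this

theorem permWord_append_hash_getElem? (hn : 0 < n) (r : Fin n) {k : ℕ} (hk : k < n + 1) :
    (permWord σ ++ [Letter.hash])[r * (n + 1) + k]? =
      some (if k = n then .hash else if k = σ r then .one else .zero) := by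
  rw [permWord_append_hash σ hn, getElem?_flatten_of_length ?_ _ hk]
  · simp only [List.getElem?_ofFn, r.is_lt, dif_pos, Option.bind_some]
    rcases (Nat.le_of_lt_succ hk).eq_or_lt with rfl | hk'
    · simp [permColumn]
    · rw [List.getElem?_append_left (by simpa [permColumn])]
      simp [permColumn, hk', hk'.ne, Fin.ext_iff]
  · intro l hl
    obtain ⟨r, rfl⟩ := (List.mem_ofFn' _ _).1 hl
    simp [permColumn]

theorem permWord_getElem? (hn : 0 < n) (r : Fin n) {k : ℕ} (hk : k < n + 1)
    (h : (r : ℕ) + 1 < n ∨ k < n) : (permWord σ)[r * (n + 1) + k]? =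
      some (if k = n then .hash else if k = σ r then .one else .zero) := by
  rw [← permWord_append_hash_getElem? σ hn r hk, List.getElem?_append_left]
  have hl := length_permWord σ hn
  have h1 := Nat.mul_le_mul_right (n + 1) (Nat.succ_le_of_lt r.is_lt)
  rw [Nat.succ_mul] at h1
  rcases h with h | h
  · have h2 := Nat.mul_le_mul_right (n + 1) (Nat.succ_le_of_lt h)
    rw [Nat.succ_mul, Nat.succ_mul] at h2
    omega
  · omega

end PermWord

/-- The tape carrying `v` consists of two sequences of `n` blocks of length `n` over `{0, 1}`, with
a single letter `1` in each block, at the offset given by `c`. -/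
structure IsGrid (n : ℕ) (c : ℕ → ℕ) (v : List Letter) : Prop where
  length_add_one : v.length + 1 = 2 * n * (n + 1)
  cell : ∀ r k, r < 2 * n → k < n →
    (tape v)[r * (n + 1) + (k + 1)]? = some (.letter (if k = c r then .one else .zero))
  sep : ∀ r, 0 < r → r < 2 * n →
    (tape v)[r * (n + 1)]? = some (.letter (if r = n then .dollar else .hash))

theorem tape_getElem?_of_getElem? {α : Type*} {u : List α} {i : ℕ} {x : α} (h : u[i]? = some x) :
    (tape u)[i + 1]? = some (.letter x) := by
  obtain ⟨hi, rfl⟩ := List.getElem?_eq_some_iff.1 h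
  exact tape_getElem?_succ u hi

/-- Two different permutations are allowed because the glued words of the fooling argument have to
be decoded as well. -/
theorem isGrid_permWord {n : ℕ} (hn : 0 < n) (σ τ : Equiv.Perm (Fin n)) :
    IsGrid n (combine n σ τ) (permWord σ ++ Letter.dollar :: permWord τ) := by
  have hσ := length_permWord σ hn
  have hτ := length_permWord τ hn
  have hleft : ∀ (r : Fin n) k, k < n + 1 → ((r : ℕ) + 1 < n ∨ k < n) →
      (permWord σ ++ Letter.dollar :: permWord τ)[r * (n + 1) + k]? =
        some (if k = n then .hash else if k = σ r then .one else .zero) := by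
    intro r k hk h
    have := permWord_getElem? σ hn r hk h
    rw [List.getElem?_append_left (List.getElem?_eq_some_iff.1 this).1, this]
  have hright : ∀ (r : Fin n) k, k < n + 1 → ((r : ℕ) + 1 < n ∨ k < n) →
      (permWord σ ++ Letter.dollar :: permWord τ)[(n + r) * (n + 1) + k]? =
        some (if k = n then .hash else if k = τ r then .one else .zero) := by
    intro r k hk h
    rw [← permWord_getElem? τ hn r hk h, List.getElem?_append_right (by rw [Nat.add_mul]; omega),
      show (n + (r : ℕ)) * (n + 1) + k - (permWord σ).length = (r * (n + 1) + k) + 1 by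
        rw [Nat.add_mul]; omega]
    rfl
  refine ⟨?_, ?_, ?_⟩
  · rw [mul_assoc, two_mul]
    simp only [List.length_append, List.length_cons]
    omega
  · intro r k hr hk
    refine tape_getElem?_of_getElem? ?_
    rcases Nat.lt_or_ge r n with h | h
    · have := hleft ⟨r, h⟩ k (by omega) (Or.inr hk)
      rw [← combine_left (h := n) σ τ ⟨r, h⟩] at this
      simpa [hk.ne] using this
    · obtain ⟨s, rfl⟩ := Nat.exists_eq_add_of_le h
      have := hright ⟨s, by omega⟩ k (by omega) (Or.inr hk)
      rw [← combine_right le_rfl σ τ ⟨s, by omega⟩] at this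
      simpa [hk.ne] using this
  · intro r h0 hr
    rcases lt_trichotomy r n with h | rfl | h
    · obtain ⟨s, rfl⟩ : ∃ s, r = s + 1 := ⟨r - 1, by omega⟩
      rw [Nat.succ_mul, ← add_assoc]
      refine tape_getElem?_of_getElem? ?_
      have := hleft ⟨s, by omega⟩ n (by omega) (Or.inl h)
      simpa [h.ne] using this
    · rw [← hσ]
      exact tape_getElem?_of_getElem? (by simp)
    · obtain ⟨s, rfl⟩ : ∃ s, r = n + s + 1 := ⟨r - n - 1, by omega⟩
      rw [Nat.succ_mul, ← add_assoc]
      refine tape_getElem?_of_getElem? ?_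
      have := hright ⟨s, by omega⟩ n (by omega) (Or.inl (by simp only; omega))
      simpa [show ¬ n + s + 1 = n by omega] using this

namespace IsGrid

variable {n : ℕ} {c c' : ℕ → ℕ} {v v' : List Letter}

/-- A grid prescribes every tape position; this turns a decoded grid back into the word of a
permutation. -/
theorem eq_of_grid (h : IsGrid n c v) (h' : IsGrid n c v') : v = v' := by
  have hl : v.length = v'.length := by
    have h1 := h.length_add_one
    have h2 := h'.length_add_one
    omega
  refine tape_injective (List.ext_getElem? fun j => ?_)
  obtain ⟨r, k, hk, rfl⟩ := exists_mul_add (show 0 < n + 1 by omega) j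
  rcases Nat.lt_or_ge r (2 * n) with hr | hr
  · rcases k with _ | k
    · rcases r.eq_zero_or_pos with rfl | h0
      · simp [tape]
      · rw [add_zero, h.sep r h0 hr, h'.sep r h0 hr]
    · rw [h.cell r k hr (by omega), h'.cell r k hr (by omega)]
  · have := Nat.mul_le_mul_right (n + 1) hr
    have h1 := h.length_add_one
    rcases (show v.length + 1 ≤ r * (n + 1) + k by omega).eq_or_lt with he | hlt
    · rw [← he, tape_getElem?_length, hl, tape_getElem?_length]
    · rw [List.getElem?_eq_none (by rw [length_tape]; omega),
        List.getElem?_eq_none (by rw [length_tape]; omega)]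

theorem value_eq (h : IsGrid n c v) (h' : IsGrid n c' v) {r : ℕ} (hr : r < 2 * n)
    (hc : c r < n) : c r = c' r := by
  have h1 := h.cell r _ hr hc
  rw [h'.cell r _ hr hc] at h1
  by_contra hne
  simp [hne] at h1

theorem letterAt_cell (h : IsGrid n c v) {r k : ℕ} (hr : r < 2 * n) (hk : k < n) (x : Letter) :
    LetterAt x v (r * (n + 1) + (k + 1)) ↔ (if k = c r then .one else .zero) = x := by
  rw [LetterAt, h.cell r k hr hk]
  simp

theorem letterAt_sep (h : IsGrid n c v) {r : ℕ} (x : Letter) :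
    LetterAt x v (r * (n + 1)) ↔ 0 < r ∧ r < 2 * n ∧ (if r = n then .dollar else .hash) = x := by
  rcases r.eq_zero_or_pos with rfl | h0
  · simp [LetterAt, tape]
  · rcases Nat.lt_or_ge r (2 * n) with hr | hr
    · rw [LetterAt, h.sep r h0 hr]
      simp [h0, hr]
    · constructor
      · intro hx
        have := hx.bounds
        have := Nat.mul_le_mul_right (n + 1) hr
        have := h.length_add_one
        omega
      · rintro ⟨-, h, -⟩; omega

theorem lt_of_le (h : IsGrid n c v) {r k : ℕ} (hj : r * (n + 1) + k ≤ v.length + 1)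
    (hk : 0 < k) : r < 2 * n := by
  by_contra hr
  have := Nat.mul_le_mul_right (n + 1) (not_lt.1 hr)
  have := h.length_add_one
  omega

end IsGrid

/-! ### The complement of `permRelation` is not recognizable -/

theorem mem_permRelation_iff {n : ℕ} (hn : 0 < n) (σ τ : Equiv.Perm (Fin n)) :
    (List.replicate n Letter.a, permWord σ ++ Letter.dollar :: permWord τ) ∈ permRelation ↔
      σ = τ := by
  constructor
  · rintro ⟨n', ρ, h1, h2⟩
    obtain rfl : n = n' := by simpa using congrArg List.length h1
    simp only at h2
    have g := isGrid_permWord hn σ τ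
    have g' := isGrid_permWord hn ρ ρ
    rw [← h2] at g'
    have key : ∀ r, r < 2 * n → combine n σ τ r = combine n ρ ρ r := fun r hr =>
      g.value_eq g' hr (combine_lt hn _ _ _)
    ext r
    have e1 := key r (by omega)
    have e2 := key (n + r) (by omega)
    rw [combine_left, combine_left] at e1
    rw [combine_right le_rfl, combine_right le_rfl] at e2
    rw [e1, e2]
  · rintro rfl
    exact ⟨n, σ, rfl, rfl⟩

theorem not_recognizable_compl_permRelation : ¬ Recognizable permRelationᶜ := by
  refine not_recognizable_compl _ (fun n => List.replicate n Letter.a) (by simp)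
    -- The cut is just before the letter `$`. For `n = 0` the subtraction truncates, but there is
    -- only one permutation.
    (fun n σ τ => permWord σ ++ Letter.dollar :: permWord τ) (fun n => n * (n + 1) - 1)
    ?_ ?_ ?_ fun n hn σ τ => mem_permRelation_iff hn σ τ
  · intro n σ τ σ' τ'
    rcases n.eq_zero_or_pos with rfl | hn
    · rw [Subsingleton.elim σ σ', Subsingleton.elim τ τ']
    · have h1 := length_permWord σ hn
      have h2 := length_permWord τ hn
      have h3 := length_permWord σ' hn
      have h4 := length_permWord τ' hn
      simp only [List.length_append, List.length_cons]
      omega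
  · intro n σ τ p hp
    rcases n.eq_zero_or_pos with rfl | hn
    · simp at hp
    · have h1 := length_permWord σ hn
      rw [List.getElem?_append_left (by omega), List.getElem?_append_left (by omega)]
  · intro n σ τ p hp
    rcases n.eq_zero_or_pos with rfl | hn
    · rw [Subsingleton.elim σ τ]
    · have h1 := length_permWord σ hn
      have h2 := length_permWord τ hn
      rw [List.getElem?_append_right (by omega), List.getElem?_append_right (by omega),
        show (permWord σ).length = (permWord τ).length by omega]

/-! ### A definable description of `permRelation` -/

/-- The symbols after which a block starts. -/
def StartsBlock (y : Option (TapeSymbol Letter)) : Prop :=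
  y = some .beginMark ∨ y = some (.letter .hash) ∨ y = some (.letter .dollar)

/-- The symbols before which a block ends. -/
def EndsBlock (y : Option (TapeSymbol Letter)) : Prop :=
  y = some (.letter .hash) ∨ y = some (.letter .dollar) ∨ y = some .endMark

/-- A locally checkable description of the pairs in `permRelation` with a nonempty first
component. -/
structure WellFormed (u v : List Letter) : Prop where
  letters : ∀ i, i ≤ u.length + 1 → (tape u)[i]? = some .beginMark ∨
    (tape u)[i]? = some (.letter .a) ∨ (tape u)[i]? = some .endMark
  single : ∀ j, j ≤ v.length + 1 → StartsBlock (tape v)[j]? →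
    ∃ k, j < k ∧ k ≤ v.length + 1 ∧ (∀ p, j < p → p < k → LetterAt .zero v p) ∧
      LetterAt .one v k ∧ ∃ e, k < e ∧ e ≤ v.length + 1 ∧
      (∀ p, k < p → p < e → LetterAt .zero v p) ∧ EndsBlock (tape v)[e]?
  block_length : ∀ j, j ≤ v.length + 1 → StartsBlock (tape v)[j]? →
    j + u.length + 1 ≤ v.length + 1 ∧ EndsBlock (tape v)[j + u.length + 1]? ∧
      ∀ l, l < u.length → ¬ EndsBlock (tape v)[j + 1 + l]?
  rows : ∃ d, d ≤ v.length + 1 ∧ LetterAt .dollar v d ∧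
    (∀ j, j < d → ¬ LetterAt .dollar v j) ∧
    (∀ j, d < j → j ≤ v.length + 1 → ¬ LetterAt .dollar v j) ∧
    ∀ i, i ≤ u.length + 1 → (tape u)[i]? = some (.letter .a) →
      (∃ j, j ≤ d ∧ LetterAt .one v j ∧ Row (LetterAt .zero v) i j) ∧
      ∃ j, d ≤ j ∧ j ≤ v.length + 1 ∧ LetterAt .one v j ∧ Row (LetterAt .zero v) i j
  terminates : Terminates (LetterAt .zero v) (LetterAt .one v) (LetterAt .dollar v)
    (u.length + 1) (v.length + 1)

namespace Definable

variable {α : Type*} {Φ Ψ : List α → List α → (ℕ → ℕ → Prop) → ℕ → ℕ → Prop}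

theorem rightEx_lt {Z : List α → ℕ → Prop} (hZ : Definable fun (_ v : List α) _ _ j => Z v j)
    (hΦ : Definable Φ) : Definable fun u v X i j =>
      ∃ k, j < k ∧ k ≤ v.length + 1 ∧ (∀ p, j < p → p < k → Z v p) ∧ Φ u v X i k := by
  refine ((rightEx hZ hΦ).exMove .stay .right).congr fun u v X i j hv => ⟨?_, ?_⟩
  · rintro ⟨k, hjk, hk, hp, h⟩
    exact ⟨i, j + 1, ⟨hv.1, by omega⟩, by simp [Moves, Move.shift], k, hjk, hk,
      fun p h1 h2 => hp p (by omega) h2, h⟩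
  · rintro ⟨i', j', -, hm, k, hjk, hk, hp, h⟩
    obtain ⟨rfl, rfl⟩ : i' = i ∧ j' = j + 1 := by
      simp [Moves, Move.shift] at hm; omega
    exact ⟨k, hjk, hk, fun p h1 h2 => hp p (by omega) h2, h⟩

theorem leftAll_lt (hΦ : Definable Φ) : Definable fun u v X i j =>
    ∀ k, k < j → Φ u v X i k := by
  refine ((leftAll (M := fun _ _ => False) (test₁ fun _ => False) hΦ).allMove .stay .left).congr
    fun u v X i j hv => ⟨fun h i' j' _ hm k hk _ => ?_, fun h k hk => ?_⟩
  · obtain ⟨rfl, rfl⟩ : i' = i ∧ j = j' + 1 := by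
      simp [Moves, Move.shift] at hm; omega
    exact h k (by omega)
  · exact h i (j - 1) ⟨hv.1, by have := hv.2; omega⟩ (by simp [Moves, Move.shift]; omega) k
      (by omega) fun _ _ _ => id

theorem rightAll_lt (hΦ : Definable Φ) : Definable fun u v X i j =>
    ∀ k, j < k → k ≤ v.length + 1 → Φ u v X i k := by
  refine ((rightAll hΦ).allMove .stay .right).congr
    fun u v X i j hv => ⟨fun h i' j' _ hm k hk hl => ?_, fun h k hk hl => ?_⟩
  · obtain ⟨rfl, rfl⟩ : i' = i ∧ j' = j + 1 := by
      simp [Moves, Move.shift] at hm; omega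
    exact h k (by omega) hl
  · exact h i (j + 1) ⟨hv.1, by omega⟩ (by simp [Moves, Move.shift]) k hk hl

theorem imp_test₁ (P : Option (TapeSymbol α) → Prop) (hΦ : Definable Φ) :
    Definable fun u v X i j => P (tape u)[i]? → Φ u v X i j :=
  ((test₁ fun y => ¬ P y).or hΦ).congr fun _ _ _ _ _ _ => imp_iff_not_or

theorem imp_test₂ (P : Option (TapeSymbol α) → Prop) (hΦ : Definable Φ) :
    Definable fun u v X i j => P (tape v)[j]? → Φ u v X i j :=
  ((test₂ fun y => ¬ P y).or hΦ).congr fun _ _ _ _ _ _ => imp_iff_not_or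

/-- The first head measures `u`. Quantifying universally over its position and accepting at once off
the begin marker resets it; then both heads walk right together until it scans the end marker. -/
theorem block_length (E : Option (TapeSymbol α) → Prop) : Definable fun (u v : List α) _ _ j =>
    j + u.length + 1 ≤ v.length + 1 ∧ E (tape v)[j + u.length + 1]? ∧
      ∀ l, l < u.length → ¬ E (tape v)[j + 1 + l]? := by
  have h := (imp_test₁ (fun y => y = some (.beginMark : TapeSymbol α))
    ((diagEx (test₂ fun y => ¬ E y) ((test₁ fun y => y = some (.endMark : TapeSymbol α)).and
      (test₂ E))).exMove .right .right)).all₁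
  refine h.congr fun u v X i j hv => ?_
  simp only [tape_getElem?_eq_beginMark, tape_getElem?_eq_endMark]
  constructor
  · rintro ⟨hl, hE, hn⟩ i' - rfl
    refine ⟨1, j + 1, ⟨by omega, by omega⟩, by simp [Moves, Move.shift], u.length,
      ⟨by omega, by omega⟩, hn, by omega, ?_⟩
    rwa [add_right_comm]
  · intro h
    obtain ⟨i', j', -, hm, k, hvk, hn, hk, hE⟩ := h 0 (Nat.zero_le _) rfl
    obtain ⟨rfl, rfl⟩ : i' = 1 ∧ j' = j + 1 := by
      simp [Moves, Move.shift] at hm; omega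
    obtain rfl : k = u.length := by omega
    have := hvk.2
    refine ⟨by omega, ?_, hn⟩
    rwa [add_right_comm]

end Definable

theorem definable_wellFormed : Definable fun u v _ _ _ => WellFormed u v := by
  have h1 := (Definable.test₁ fun y : Option (TapeSymbol Letter) =>
    y = some .beginMark ∨ y = some (.letter .a) ∨ y = some .endMark).all₁
  have h2 := (Definable.imp_test₂ StartsBlock (Definable.rightEx_lt (definable_letterAt .zero)
    ((definable_letterAt .one).and (Definable.rightEx_lt (definable_letterAt .zero)
    (Definable.test₂ EndsBlock))))).all₂
  have h3 := (Definable.imp_test₂ StartsBlock (Definable.block_length EndsBlock)).all₂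
  have hrow := (definable_letterAt Letter.one).and (Definable.row
    (definable_letterAt Letter.zero) (definable_not_letterAt Letter.zero))
  have h4 := ((definable_letterAt Letter.dollar).and
    ((definable_not_letterAt Letter.dollar).leftAll_lt.and
    ((definable_not_letterAt Letter.dollar).rightAll_lt.and
    (Definable.imp_test₁ (fun y => y = some (.letter .a))
      (hrow.leftEx.and (Definable.rightEx (Z := fun _ _ => True) (Definable.test₁ fun _ => True)
        hrow))).all₁))).ex₂
  have h5 := Definable.terminates (definable_letterAt Letter.zero)
    (definable_not_letterAt Letter.zero) (definable_not_letterAt Letter.one)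
    (definable_letterAt Letter.dollar)
  refine (h1.and (h2.and (h3.and (h4.and h5)))).congr fun u v X i j hv => ⟨fun h => ?_, ?_⟩
  · refine ⟨h.letters, h.single, h.block_length, ?_, h.terminates⟩
    simpa using h.rows
  · rintro ⟨h1, h2, h3, h4, h5⟩
    refine ⟨h1, h2, h3, ?_, h5⟩
    simpa using h4

/-! ### Codes of permutations are well-formed -/

theorem IsGrid.wellFormed {n : ℕ} (hn : 0 < n) (σ : Equiv.Perm (Fin n)) {v : List Letter}
    (h : IsGrid n (combine n σ σ) v) : WellFormed (List.replicate n Letter.a) v := by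
  set c := combine n σ σ with hc
  have hcn : ∀ r, c r < n := combine_lt hn σ σ
  have hlen := h.length_add_one
  have hend : (tape v)[2 * n * (n + 1)]? = some .endMark := by
    rw [← hlen, tape_getElem?_length]
  have hpos : ∀ r k, r < 2 * n → k < n + 1 → r * (n + 1) + k < v.length + 1 := by
    intro r k hr hk
    rw [hlen]
    exact mul_add_lt_mul_add (k := 0) hr hk
  have hends : ∀ r, r < 2 * n → EndsBlock (tape v)[(r + 1) * (n + 1)]? := by
    intro r hr
    rcases (Nat.succ_le_of_lt hr).eq_or_lt with he | hlt
    · have he : r + 1 = 2 * n := he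
      rw [he, hend]
      exact Or.inr (Or.inr rfl)
    · rw [h.sep (r + 1) (by omega) hlt]
      unfold EndsBlock
      split_ifs <;> simp
  have hstart : ∀ j, j ≤ v.length + 1 → StartsBlock (tape v)[j]? →
      ∃ r, r < 2 * n ∧ j = r * (n + 1) := by
    intro j hj hs
    obtain ⟨r, k, hk, rfl⟩ := exists_mul_add (show 0 < n + 1 by omega) j
    rcases k with _ | k
    · refine ⟨r, ?_, rfl⟩
      by_contra hr
      have := Nat.mul_le_mul_right (n + 1) (not_lt.1 hr)
      rw [show r * (n + 1) + 0 = 2 * n * (n + 1) by omega, hend] at hs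
      simp [StartsBlock] at hs
    · have hr := h.lt_of_le hj (by omega)
      rw [h.cell r k hr (by omega)] at hs
      unfold StartsBlock at hs
      split_ifs at hs <;> simp at hs
  have hone : ∀ r, r < 2 * n → LetterAt .one v (r * (n + 1) + (c r + 1)) := fun r hr =>
    (h.letterAt_cell hr (hcn r) _).2 (if_pos rfl)
  have hzero : ∀ r k, r < 2 * n → k < n → k ≠ c r → LetterAt .zero v (r * (n + 1) + (k + 1)) :=
    fun r k hr hk hkc => (h.letterAt_cell hr hk _).2 (if_neg hkc)
  have hrow : ∀ r, r < 2 * n → ∀ i, Row (LetterAt .zero v) i (r * (n + 1) + (c r + 1)) ↔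
      i = c r + 1 := by
    intro r hr i
    have := hcn r
    rw [row_iff (p := r * (n + 1)) (by omega) ?_ fun l h1 h2 => ?_]
    · omega
    · rw [h.letterAt_sep]
      split_ifs <;> simp
    · obtain ⟨k, rfl⟩ := Nat.exists_eq_add_of_lt h1
      exact hzero r k hr (by omega) (by omega)
  have hdollar : ∀ j, LetterAt .dollar v j ↔ j = n * (n + 1) := by
    intro j
    constructor
    · intro hj
      have hb := hj.bounds
      obtain ⟨r, k, hk, rfl⟩ := exists_mul_add (show 0 < n + 1 by omega) j
      rcases k with _ | k
      · rw [add_zero, h.letterAt_sep] at hj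
        by_cases hr : r = n
        · rw [hr, add_zero]
        · simp [hr] at hj
      · have hr := h.lt_of_le (show r * (n + 1) + (k + 1) ≤ v.length + 1 by omega) (by omega)
        rw [h.letterAt_cell hr (by omega)] at hj
        split_ifs at hj
    · rintro rfl
      exact (h.letterAt_sep _).2 ⟨hn, by omega, if_pos rfl⟩
  have hlt : ∀ r : Fin n, c r < n + 1 := fun r => by have := hcn r; omega
  have hl : ∀ r : Fin n, c r = σ r := fun r => combine_left σ σ r
  have hr : ∀ r : Fin n, c (n + r) = σ r := fun r => combine_right le_rfl σ σ r
  have hσ : ∀ r : Fin n, (σ r : ℕ) + 1 < n + 1 := fun r => by have := (σ r).is_lt; omega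
  refine ⟨fun i hi => ?_, fun j hj hs => ?_, fun j hj hs => ?_, ?_, ?_⟩
  · rcases i with _ | i
    · exact Or.inl rfl
    · rcases (Nat.le_of_succ_le_succ hi).eq_or_lt with rfl | hi
      · exact Or.inr (Or.inr (tape_getElem?_length _))
      · rw [tape_getElem?_succ _ hi, List.getElem_replicate]
        exact Or.inr (Or.inl rfl)
  · obtain ⟨r, hr, rfl⟩ := hstart j hj hs
    have hcr := hcn r
    have hb := hpos r (c r + 1) hr (by omega)
    have hb' := hpos r n hr (by omega)
    refine ⟨r * (n + 1) + (c r + 1), by omega, by omega, fun p h1 h2 => ?_, hone r hr,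
      (r + 1) * (n + 1), ?_, ?_, fun p h1 h2 => ?_, hends r hr⟩
    · obtain ⟨k, rfl⟩ := Nat.exists_eq_add_of_lt h1
      exact hzero r k hr (by omega) (by omega)
    · rw [Nat.succ_mul]; omega
    · rw [Nat.succ_mul]; omega
    · rw [Nat.succ_mul] at h2
      obtain ⟨k, rfl⟩ := Nat.exists_eq_add_of_lt (show r * (n + 1) < p by omega)
      exact hzero r k hr (by omega) (by omega)
  · obtain ⟨r, hr, rfl⟩ := hstart j hj hs
    have hb' := hpos r n hr (by omega)
    rw [List.length_replicate]
    refine ⟨by omega, ?_, fun l hl => ?_⟩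
    · have := hends r hr
      rwa [Nat.succ_mul, ← add_assoc] at this
    · rw [add_right_comm, add_assoc, h.cell r l hr hl]
      unfold EndsBlock
      split_ifs <;> simp
  · have hb := hpos n 0 (by omega) (by omega)
    refine ⟨n * (n + 1), by omega, (hdollar _).2 rfl, fun j hj h => ?_, fun j hj _ h => ?_,
      fun i hi ha => ?_⟩
    · have := (hdollar j).1 h; omega
    · have := (hdollar j).1 h; omega
    · have hi0 : i ≠ 0 := by rintro rfl; simp [tape] at ha
      have hin : i ≠ n + 1 := by
        rintro rfl
        have := tape_getElem?_length (List.replicate n Letter.a)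
        rw [List.length_replicate, ha] at this
        simp at this
      rw [List.length_replicate] at hi
      obtain ⟨r, hrs⟩ := σ.surjective ⟨i - 1, by omega⟩
      have hri : (σ r : ℕ) + 1 = i := by rw [hrs]; simp only; omega
      refine ⟨⟨_, ?_, hone r (by omega), (hrow r (by omega) i).2 (by rw [hl, hri])⟩,
        ⟨_, ?_, ?_, hone (n + r) (by omega), (hrow (n + r) (by omega) i).2 (by rw [hr, hri])⟩⟩
      · rw [hl]; exact (mul_add_lt_mul_add (k := 0) r.is_lt (hσ r)).le
      · rw [Nat.add_mul]; omega
      · rw [hr]; exact (hpos _ _ (by omega) (hσ r)).le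
  · rw [List.length_replicate]
    refine (terminates_iff_perm_eq (c := 1) σ σ (fun r => r * (n + 1) + (σ r + 1))
      (fun r => (n + r) * (n + 1) + (σ r + 1)) ?_ ?_ ?_ ?_ ?_ ?_ ?_ ?_ ?_ ?_ ?_).2 rfl
    · exact fun r' r h => mul_add_lt_mul_add h (hσ r')
    · exact fun r' r h => mul_add_lt_mul_add (by simpa using h) (hσ r')
    · exact fun r => (hpos _ _ (by omega) (hσ r)).le
    · exact fun r => (hpos _ _ (by omega) (hσ r)).le
    · intro j hj
      obtain ⟨r, k, hk, rfl⟩ := exists_mul_add (show 0 < n + 1 by omega) j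
      constructor
      · intro ho
        rcases k with _ | k
        · rw [add_zero, h.letterAt_sep] at ho
          split_ifs at ho <;> simp at ho
        · have hr2 := h.lt_of_le hj (by omega)
          rw [h.letterAt_cell hr2 (by omega)] at ho
          have hkc : k = c r := by
            by_contra hne
            simp [hne] at ho
          subst hkc
          rcases Nat.lt_or_ge r n with h | h
          · exact Or.inl ⟨⟨r, h⟩, by rw [← hl]⟩
          · refine Or.inr ⟨⟨r - n, by omega⟩, ?_⟩
            rw [← hr]
            simp only [show n + (r - n) = r by omega]
      · rintro (⟨s, hs⟩ | ⟨s, hs⟩)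
        · rw [hs, ← hl]; exact hone _ (by omega)
        · rw [hs, ← hr]; exact hone _ (by omega)
    · intro r i
      have := hrow r (by omega) i
      rwa [hl] at this
    · intro r i
      have := hrow (n + r) (by omega) i
      rwa [hr] at this
    · intro r r'
      refine ⟨n * (n + 1), mul_add_lt_mul_add (k := 0) r.is_lt (hσ r), ?_, (hdollar _).2 rfl⟩
      rw [Nat.add_mul]; omega
    · intro r' r x h1 h2 hx
      rw [hdollar] at hx
      have := mul_add_lt_mul_add (k := 0) r.is_lt (hσ r)
      omega
    · intro r' r x h1 h2 hx
      rw [hdollar] at hx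
      rw [Nat.add_mul] at h1
      omega
    · intro k; omega

/-! ### Decoding well-formed words -/

theorem StartsBlock.not_letterAt {v : List Letter} {j : ℕ} (h : StartsBlock (tape v)[j]?) :
    ¬ LetterAt .zero v j ∧ ¬ LetterAt .one v j := by
  unfold LetterAt
  rcases h with h | h | h <;> rw [h] <;> simp

theorem EndsBlock.not_letterAt {v : List Letter} {j : ℕ} (h : EndsBlock (tape v)[j]?) :
    ¬ LetterAt .zero v j ∧ ¬ LetterAt .one v j := by
  unfold LetterAt
  rcases h with h | h | h <;> rw [h] <;> simp

theorem EndsBlock.startsBlock {v : List Letter} {j : ℕ} (h : EndsBlock (tape v)[j]?)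
    (hj : j < v.length + 1) : StartsBlock (tape v)[j]? := by
  rcases h with h | h | h
  · exact Or.inr (Or.inl h)
  · exact Or.inr (Or.inr h)
  · exact absurd ((tape_getElem?_eq_endMark v).1 h) hj.ne

namespace WellFormed

variable {u v : List Letter}

theorem getElem_eq (h : WellFormed u v) {i : ℕ} (hi : i < u.length) : u[i] = Letter.a := by
  have := h.letters (i + 1) (by omega)
  rw [tape_getElem?_succ u hi] at this
  simpa using this

theorem eq_replicate (h : WellFormed u v) : u = List.replicate u.length Letter.a := by
  refine List.eq_replicate_of_mem fun x hx => ?_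
  obtain ⟨i, hi, rfl⟩ := List.getElem_of_mem hx
  exact h.getElem_eq hi

/-- A block consists of letters `0` and a single letter `1`. -/
theorem exists_value (h : WellFormed u v) {j : ℕ} (hj : j ≤ v.length + 1)
    (hs : StartsBlock (tape v)[j]?) : ∃ s, s < u.length ∧ ∀ k, k < u.length →
      (tape v)[j + (k + 1)]? = some (.letter (if k = s then .one else .zero)) := by
  obtain ⟨a, hja, ha, hza, hone, e, hae, he, hze, hend⟩ := h.single j hj hs
  obtain ⟨hle, hend', hn⟩ := h.block_length j hj hs
  -- The end `e` found by `single` coincides with the one at distance `u.length + 1`: no earlier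
  -- position ends a block, and before `e` only the letters `0` and `1` occur.
  have h1 : ¬ e < j + u.length + 1 := fun hlt => by
    refine hn (e - j - 1) (by omega) ?_
    rwa [show j + 1 + (e - j - 1) = e by omega]
  have h2 : ¬ j + u.length + 1 < e := fun hlt => by
    rcases lt_trichotomy (j + u.length + 1) a with h | h | h
    · exact hend'.not_letterAt.1 (hza _ (by omega) h)
    · exact hend'.not_letterAt.2 (h ▸ hone)
    · exact hend'.not_letterAt.1 (hze _ h hlt)
  refine ⟨a - j - 1, by omega, fun k hk => ?_⟩
  split_ifs with hka
  · rwa [show j + (k + 1) = a by omega]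
  · rcases lt_or_gt_of_ne (show j + (k + 1) ≠ a by omega) with h | h
    · exact hza _ (by omega) h
    · exact hze _ h (by omega)

/-- The tape carrying `v` is divided into blocks of the length of `u`. -/
theorem exists_blocks (h : WellFormed u v) : ∃ m, v.length + 1 = m * (u.length + 1) ∧
    (∀ r, r < m → StartsBlock (tape v)[r * (u.length + 1)]?) ∧
    ∀ r, 0 < r → r < m → EndsBlock (tape v)[r * (u.length + 1)]? := by
  set n := u.length with hn
  have hK : 0 < n + 1 := Nat.succ_pos n
  -- Separators propagate from the begin marker: each one starts a block, which ends exactly `n + 1`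
  -- positions later.
  have hsep : ∀ r, r * (n + 1) ≤ v.length + 1 → r = 0 ∨ EndsBlock (tape v)[r * (n + 1)]? := by
    intro r
    induction r with
    | zero => exact fun _ => Or.inl rfl
    | succ r ih =>
      intro hr
      rw [Nat.succ_mul] at hr
      have hs : StartsBlock (tape v)[r * (n + 1)]? := by
        rcases ih (by omega) with rfl | he
        · rw [zero_mul]; exact Or.inl rfl
        · exact he.startsBlock (by omega)
      have := (h.block_length _ (by omega) hs).2.1
      rw [← hn, add_assoc, ← Nat.succ_mul] at this
      exact Or.inr this
  have hstart : ∀ r, r * (n + 1) < v.length + 1 → StartsBlock (tape v)[r * (n + 1)]? := by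
    intro r hr
    rcases hsep r hr.le with rfl | he
    · rw [zero_mul]; exact Or.inl rfl
    · exact he.startsBlock hr
  obtain ⟨m, k, hk, hm⟩ := exists_mul_add hK (v.length + 1)
  -- Otherwise the last block would run past the end marker.
  have hk0 : k = 0 := by
    by_contra hk0
    have := (h.block_length _ (by omega) (hstart m (by omega))).1
    omega
  rw [hk0, add_zero] at hm
  refine ⟨m, hm, fun r hr => hstart r ?_, fun r h0 hr => (hsep r ?_).resolve_left h0.ne'⟩
  · rw [hm]; exact Nat.mul_lt_mul_of_pos_right hr hK
  · rw [hm]; exact Nat.mul_le_mul_right _ hr.le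

/-- Each block `r` has a value `s r`. By `rows` every value occurs on both sides of the letter `$`,
and a repetition on one side would be a loop of the order game; so each side enumerates `Fin n`
bijectively and has `n` blocks. Reversed pairs would be two-cycles, so the two enumerations
coincide. -/
theorem exists_isGrid (h : WellFormed u v) : 0 < u.length ∧
    ∃ σ : Equiv.Perm (Fin u.length), IsGrid u.length (combine u.length σ σ) v := by
  obtain ⟨m, hL, hstart, hends⟩ := h.exists_blocks
  set n := u.length with hn
  have hK : 0 < n + 1 := Nat.succ_pos n
  have hval : ∀ r, ∃ s, r < m → s < n ∧ ∀ k, k < n →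
      (tape v)[r * (n + 1) + (k + 1)]? = some (.letter (if k = s then .one else .zero)) := by
    intro r
    by_cases hr : r < m
    · obtain ⟨s, hs⟩ := h.exists_value (by rw [hL]; exact Nat.mul_le_mul_right _ hr.le)
        (hstart r hr)
      exact ⟨s, fun _ => hs⟩
    · exact ⟨0, fun h => absurd h hr⟩
  choose s hs using hval
  have hsn : ∀ r, r < m → s r + 1 < n + 1 := fun r hr => Nat.succ_lt_succ (hs r hr).1
  have hm : 0 < m := by
    rcases m.eq_zero_or_pos with rfl | hm
    · simp at hL
    · exact hm
  have hn0 : 0 < n := by have := hsn 0 hm; omega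
  have hcell : ∀ r k x, r < m → k < n → (LetterAt x v (r * (n + 1) + (k + 1)) ↔
      (if k = s r then .one else .zero) = x) := by
    intro r k x hr hk
    rw [LetterAt, (hs r hr).2 k hk]
    simp
  have hpos : ∀ r k, r < m → k < n + 1 → r * (n + 1) + k < v.length + 1 := by
    intro r k hr hk
    rw [hL]
    exact mul_add_lt_mul_add (k := 0) hr hk
  have hdecomp : ∀ j, j < v.length + 1 → ∃ r k, r < m ∧ k < n + 1 ∧ j = r * (n + 1) + k := by
    intro j hj
    obtain ⟨r, k, hk, rfl⟩ := exists_mul_add hK j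
    refine ⟨r, k, ?_, hk, rfl⟩
    by_contra hr
    have := Nat.mul_le_mul_right (n + 1) (not_lt.1 hr)
    omega
  have hone : ∀ r, r < m → LetterAt .one v (r * (n + 1) + (s r + 1)) := fun r hr =>
    (hcell r _ _ hr (hs r hr).1).2 (if_pos rfl)
  have hone' : ∀ j, LetterAt .one v j → ∃ r, r < m ∧ j = r * (n + 1) + (s r + 1) := by
    intro j hj
    obtain ⟨r, k, hr, hk, rfl⟩ := hdecomp j (by have := hj.bounds; omega)
    rcases k with _ | k
    · exact absurd hj (hstart r hr).not_letterAt.2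
    · rw [hcell r k _ hr (by omega)] at hj
      refine ⟨r, hr, ?_⟩
      by_cases hks : k = s r
      · rw [hks]
      · simp [hks] at hj
  have hrow : ∀ r, r < m → ∀ i, Row (LetterAt .zero v) i (r * (n + 1) + (s r + 1)) ↔
      i = s r + 1 := by
    intro r hr i
    have := hsn r hr
    rw [row_iff (p := r * (n + 1)) (by omega) (hstart r hr).not_letterAt.1 fun l h1 h2 => ?_]
    · omega
    · obtain ⟨k, rfl⟩ := Nat.exists_eq_add_of_lt h1
      exact (hcell r k _ hr (by omega)).2 (if_neg (by omega))
  obtain ⟨d, hd, hdd, hleft, hright, hrows⟩ := h.rows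
  obtain ⟨b, k, hb, hk, rfl⟩ := hdecomp d (by have := hdd.bounds; omega)
  obtain rfl : k = 0 := by
    rcases k with _ | k
    · rfl
    · rw [hcell b k _ hb (by omega)] at hdd
      split_ifs at hdd
  rw [add_zero] at hd hdd hleft hright hrows
  have hb0 : 0 < b := Nat.pos_of_ne_zero fun h0 => by
    rw [h0, zero_mul] at hdd
    have := hdd.bounds
    omega
  have hdollar : ∀ j, j ≤ v.length + 1 → LetterAt .dollar v j → j = b * (n + 1) := by
    intro j hj hjd
    rcases lt_trichotomy j (b * (n + 1)) with hlt | heq | hlt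
    · exact absurd hjd (hleft j hlt)
    · exact heq
    · exact absurd hjd (hright j hlt hj)
  have hsurj : ∀ x, x < n → (∃ r, r < b ∧ s r = x) ∧ ∃ r, b ≤ r ∧ r < m ∧ s r = x := by
    intro x hx
    obtain ⟨⟨j, hj, hoj, hrj⟩, ⟨j', hj', -, hoj', hrj'⟩⟩ := hrows (x + 1) (by omega) (by
      rw [tape_getElem?_succ u hx, h.getElem_eq hx])
    obtain ⟨r, hr, rfl⟩ := hone' j hoj
    obtain ⟨r', hr', rfl⟩ := hone' j' hoj'
    rw [hrow r hr] at hrj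
    rw [hrow r' hr'] at hrj'
    refine ⟨⟨r, ?_, by omega⟩, ⟨r', ?_, hr', by omega⟩⟩
    · by_contra hbr
      have := Nat.mul_le_mul_right (n + 1) (not_lt.1 hbr)
      omega
    · by_contra hbr
      have := mul_add_lt_mul_add (k := 0) (not_le.1 hbr) (hsn r' hr')
      omega
  have hedge : ∀ r' r, r' < r → r < m → (r < b ∨ b ≤ r') →
      Edge (LetterAt .zero v) (LetterAt .one v) (LetterAt .dollar v) (v.length + 1)
        (s r + 1) (s r' + 1) := by
    intro r' r hr' hr hside
    have hlt := hpos r _ hr (hsn r hr)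
    refine ⟨_, hlt.le, hone r hr, (hrow r hr _).2 rfl, _,
      mul_add_lt_mul_add hr' (hsn r' (hr'.trans hr)), fun p h1 h2 hp => ?_, hone r' (hr'.trans hr),
      (hrow r' (hr'.trans hr) _).2 rfl⟩
    have hpb := hdollar p (by omega) hp
    rcases hside with hside | hside
    · have := mul_add_lt_mul_add (k := 0) hside (hsn r hr)
      omega
    · have := Nat.mul_le_mul_right (n + 1) hside
      omega
  have hne : ∀ r' r, r' < r → r < m → (r < b ∨ b ≤ r') → s r ≠ s r' := by
    intro r' r hr' hr hside heq
    have he := hedge r' r hr' hr hside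
    have := hsn r hr
    rw [← heq] at he
    exact h.terminates.not_edge (by omega) (by omega) he he
  have hbij₁ : Function.Bijective fun r : Fin b =>
      (⟨s r, (hs r (r.is_lt.trans hb)).1⟩ : Fin n) := by
    constructor
    · intro r r' heq
      have heq : s r = s r' := congrArg Fin.val heq
      rcases lt_trichotomy r r' with hlt | rfl | hlt
      · exact absurd heq.symm (hne r r' hlt (r'.is_lt.trans hb) (Or.inl r'.is_lt))
      · rfl
      · exact absurd heq (hne r' r hlt (r.is_lt.trans hb) (Or.inl r.is_lt))
    · intro x
      obtain ⟨r, hr, hx⟩ := (hsurj x x.is_lt).1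
      exact ⟨⟨r, hr⟩, Fin.ext hx⟩
  have hbij₂ : Function.Bijective fun r : Fin (m - b) =>
      (⟨s (b + r), (hs (b + r) (by omega)).1⟩ : Fin n) := by
    constructor
    · intro r r' heq
      have heq : s (b + r) = s (b + r') := congrArg Fin.val heq
      rcases lt_trichotomy r r' with hlt | rfl | hlt
      · exact absurd heq.symm (hne _ _ (Nat.add_lt_add_left hlt b) (by omega) (Or.inr (by omega)))
      · rfl
      · exact absurd heq (hne _ _ (Nat.add_lt_add_left hlt b) (by omega) (Or.inr (by omega)))
    · intro x
      obtain ⟨r, hbr, hr, hx⟩ := (hsurj x x.is_lt).2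
      refine ⟨⟨r - b, by omega⟩, Fin.ext ?_⟩
      simp only [show b + (r - b) = r by omega, hx]
  obtain rfl : b = n := by simpa using Fintype.card_of_bijective hbij₁
  have hm2 : m - n = n := by simpa using Fintype.card_of_bijective hbij₂
  have hbij₂' : Function.Bijective fun r : Fin n =>
      (⟨s (n + r), (hs (n + r) (by omega)).1⟩ : Fin n) := by
    have := hbij₂.comp (finCongr hm2.symm).bijective
    exact this
  have hστ := perm_eq_of_forall_not_reversed (Equiv.ofBijective _ hbij₁)
    (Equiv.ofBijective _ hbij₂') fun r' r q' q hr hq h1 h2 => by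
      have h1 : s r = s (n + q') := congrArg Fin.val h1
      have h2 : s r' = s (n + q) := congrArg Fin.val h2
      have e1 := hedge r' r hr (by omega) (Or.inl r.is_lt)
      have e2 := hedge (n + q') (n + q) (Nat.add_lt_add_left hq n) (by omega) (Or.inr (by omega))
      rw [← h1, ← h2] at e2
      have := hsn r (by omega)
      have := hsn r' (by omega)
      exact h.terminates.not_edge (by omega) (by omega) e1 e2
  refine ⟨hn0, Equiv.ofBijective _ hbij₁, ⟨by rw [hL]; congr 1; omega, fun r k hr hk => ?_,
    fun r h0 hr => ?_⟩⟩
  · rw [(hs r (by omega)).2 k hk]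
    congr 4
    rcases Nat.lt_or_ge r n with hrb | hrb
    · exact (combine_left (Equiv.ofBijective _ hbij₁) (Equiv.ofBijective _ hbij₁) ⟨r, hrb⟩).symm
    · obtain ⟨q, rfl⟩ := Nat.exists_eq_add_of_le hrb
      rw [hστ]
      exact (combine_right le_rfl (Equiv.ofBijective _ hbij₂') (Equiv.ofBijective _ hbij₂')
        ⟨q, show q < n by omega⟩).symm
  · have hlt := hpos r 0 (by omega) hK
    rcases hends r h0 (by omega) with he | he | he
    · rw [he, if_neg]
      rintro rfl
      rw [LetterAt, he] at hdd
      simp at hdd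
    · have := hdollar _ hlt.le he
      rw [he, if_pos (Nat.eq_of_mul_eq_mul_right hK this)]
    · have := (tape_getElem?_eq_endMark v).1 he
      omega

end WellFormed

/-! ### Recognizing `permRelation` -/

/-- `WellFormed` requires a letter `1` in the first block, which rules out `n = 0`; that pair is
listed separately. -/
theorem mem_permRelation_iff_wellFormed (u v : List Letter) :
    (u, v) ∈ permRelation ↔ (u = [] ∧ v = [Letter.dollar]) ∨ WellFormed u v := by
  constructor
  · rintro ⟨n, σ, hu, hv⟩
    simp only at hu hv
    rcases n.eq_zero_or_pos with rfl | hn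
    · left
      simp [hu, hv, permWord]
    · right
      have g := isGrid_permWord hn σ σ
      rw [← hv] at g
      rw [hu]
      exact g.wellFormed hn σ
  · rintro (⟨rfl, rfl⟩ | h)
    · exact ⟨0, 1, rfl, by simp [permWord]⟩
    · obtain ⟨hn, σ, g⟩ := h.exists_isGrid
      exact ⟨u.length, σ, h.eq_replicate, g.eq_of_grid (isGrid_permWord hn σ σ)⟩

/-- Evaluated at the initial head positions, this singles out the pair of the empty word and the
one-letter word `x`, the case `n = 0`. -/
theorem definable_start_letter_end {α : Type*} (x : α) : Definable fun (u v : List α) _ i j =>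
    ∃ i' j', Valid u v i' j' ∧ Moves .right .right i j i' j' ∧
      ((tape u)[i']? = some .endMark ∧ (tape v)[j']? = some (.letter x) ∧
        ∃ i'' j'', Valid u v i'' j'' ∧ Moves .stay .right i' j' i'' j'' ∧
          (tape v)[j'']? = some .endMark) :=
  ((Definable.test₁ fun y => y = some .endMark).and
    ((Definable.test₂ fun y => y = some (.letter x)).and
    ((Definable.test₂ fun y => y = some .endMark).exMove .stay .right))).exMove .right .right

theorem recognizable_permRelation : Recognizable permRelation := by
  convert ((definable_start_letter_end Letter.dollar).or definable_wellFormed).recognizable using 1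
  ext ⟨u, v⟩
  rw [mem_permRelation_iff_wellFormed]
  refine or_congr ⟨?_, ?_⟩ Iff.rfl
  · rintro ⟨rfl, rfl⟩
    exact ⟨1, 1, by simp [Valid], by simp [Moves, Move.shift], rfl, rfl, 1, 2, by simp [Valid],
      by simp [Moves, Move.shift], rfl⟩
  · rintro ⟨i, j, -, hm, hi, hj, i', j', -, hm', hj'⟩
    obtain ⟨rfl, rfl⟩ : i = 1 ∧ j = 1 := by
      simp [Moves, Move.shift] at hm; omega
    obtain rfl : j' = 2 := by
      simp [Moves, Move.shift] at hm'; omega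
    replace hi := (tape_getElem?_eq_endMark u).1 hi
    replace hj' := (tape_getElem?_eq_endMark v).1 hj'
    obtain ⟨y, rfl⟩ := List.length_eq_one_iff.1 (show v.length = 1 by omega)
    refine ⟨List.length_eq_zero_iff.1 (by omega), ?_⟩
    simpa [tape] using hj

end TwoTape

theorem theorem1 :
    (∀ (α : Type*) [Finite α] [Nontrivial α],
      ∃ R : Set (List α × List α),
        TwoTape.Recognizable R ∧ ¬ TwoTape.Recognizable Rᶜ) ∧
    (TwoTape.Recognizable TwoTape.permRelation ∧
      ¬ TwoTape.Recognizable TwoTape.permRelationᶜ) :=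
  ⟨fun α _ _ => TwoTape.exists_recognizable_not_recognizable_compl α,
    TwoTape.recognizable_permRelation, TwoTape.not_recognizable_compl_permRelation⟩
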